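/- Conventions. A function on an open set $U\subset\mathbb C^n$ with values in $[-\infty,+\infty)$ is psh if it is upper semicontinuous, not identically $-\infty$, and satisfies the sub-mean value inequality on every closed disc of a complex line contained in $U$. A function $\varphi$ on an analytic subvariety $X\subset\mathbb C^n$ is psh if $\varphi\not\equiv-\infty$ on $X$ and $\varphi$ is locally, near every point of $X$, the restriction to $X$ of a psh function on an open subset of $\mathbb C^n$. The Lelong class $\mathcal L(X)$ is the set of psh functions $\varphi$ on $X$ such that $\varphi(z)\le\log^+\|z\|+C$ on $X$ for some constant $C$ depending on $\varphi$. Embed $\mathbb C^2$ in $\mathbb P^2$ by $z=(x,y)\mapsto[1:z]=[1:x:y]$, with homogeneous coordinates $[t:x:y]$, and put $\rho(1,z)=\log\sqrt{1+\|z\|^2}$. Let $X=\{(x,y)\in\mathbb C^2: xy=x^3+1\}$ and let $\overline X$ be its closure in $\mathbb P^2$. Then: 1. $X$ is an irreducible cubic: the polynomial $xy-x^3-1$ is irreducible of degree $3$. One has $\overline X=\{[t:x:y]: xyt=x^3+t^3\}=X\cup\{a\}$ with $a=[0:0:1]$, a point at infinity. Moreover $X$ is the graph of $y=x^2+x^{-1}$,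 $x\in\mathbb C^\star=\mathbb C\setminus\{0\}$. 2. The germ $(\overline X,a)$ has exactly two irreducible components $X_1,X_2$, and is their union. Both are smooth at $a$; $X_1$ is tangent to the line $\{x=0\}$ and $X_2$ is tangent to the line $\{t=0\}$. If $(x,y)\in X$ and $x\to0$, then $[1:x:y]\to a$ along $X_1$; if $(x,y)\in X$ and $x\to\infty$, then $[1:x:y]\to a$ along $X_2$. 3. The function $u(x,y)=\max\{-\log|x|,\,2\log|x|+1\}$ is psh in $\mathbb C^\star\times\mathbb C$, its restriction $\eta=u|_X$ lies in $\mathcal L(X)$, and $$\limsup_{X_1\ni[1:\zeta]\to a}(\eta(\zeta)-\rho(1,\zeta))=0,\qquad \limsup_{X_2\ni[1:\zeta]\to a}(\eta(\zeta)-\rho(1,\zeta))=1.$$ 4. $\eta$ has no extension in $\mathcal L(\mathbb C^2)$: there is no $\psi\in\mathcal L(\mathbb C^2)$ with $\psi=\eta$ on $X$. -/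

import Mathlib

open Filter Topology Set MeasureTheory
open scoped LinearAlgebra.Projectivization

noncomputable section

/-- Complex `n`-space with its Euclidean norm. -/
abbrev Cn (n : ℕ) : Type := EuclideanSpace ℂ (Fin n)

/-! ### Plurisubharmonic functions and the Lelong classes -/

/-- The mean value over the unit circle of an extended-real function, as a Lebesgue integral
(integral of the positive part minus integral of the negative part, over `(0, 2π]`, divided by
`2π`).  It is only used for functions that are bounded above on the circle, so that
the first term is finite; the value may be `-∞`. -/
def circleMean (v : ℂ → EReal) : EReal :=
  ((ENNReal.ofReal (2 * Real.pi)⁻¹ *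
      ∫⁻ θ in Set.Ioc (0 : ℝ) (2 * Real.pi), (v (circleMap 0 1 θ)).toENNReal : ENNReal) : EReal) -
  ((ENNReal.ofReal (2 * Real.pi)⁻¹ *
      ∫⁻ θ in Set.Ioc (0 : ℝ) (2 * Real.pi), (-v (circleMap 0 1 θ)).toENNReal : ENNReal) : EReal)

/-- `u` is plurisubharmonic on the open set `U` of complex `n`-space: it takes values in `[-∞, ∞)`,
is not identically `-∞`, is upper semicontinuous, and satisfies the sub-mean value inequality
on every closed disc `{z + ζ w : |ζ| ≤ 1}` of a complex line that is contained in `U`. -/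
structure IsPsh {n : ℕ} (U : Set (Cn n)) (u : Cn n → EReal) : Prop where
  isOpen : IsOpen U
  ne_top : ∀ z ∈ U, u z ≠ ⊤
  exists_ne_bot : ∃ z ∈ U, u z ≠ ⊥
  usc : UpperSemicontinuousOn u U
  le_circleMean : ∀ z w : Cn n, (∀ ζ : ℂ, ‖ζ‖ ≤ 1 → z + ζ • w ∈ U) →
    u z ≤ circleMean (fun ζ => u (z + ζ • w))

/-- `φ` is plurisubharmonic on the subvariety `X`: it is not identically `-∞` on `X` and it is
locally the restriction of a plurisubharmonic function of the ambient space.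
Only the values of `φ` on `X` matter. -/
structure IsPshOnVariety {n : ℕ} (X : Set (Cn n)) (φ : Cn n → EReal) : Prop where
  exists_ne_bot : ∃ z ∈ X, φ z ≠ ⊥
  locally_restriction : ∀ z ∈ X, ∃ (U : Set (Cn n)) (u : Cn n → EReal),
    z ∈ U ∧ IsPsh U u ∧ ∀ w ∈ X ∩ U, φ w = u w

/-- The Lelong class of order `γ` on `X`: plurisubharmonic functions `φ` on `X` with
`φ(z) ≤ γ log⁺ ‖z‖ + C` on `X`, where the constant `C` may depend on `φ`. -/
def LelongClass {n : ℕ} (γ : ℝ) (X : Set (Cn n)) : Set (Cn n → EReal) :=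
  {φ | IsPshOnVariety X φ ∧
    ∃ C : ℝ, ∀ z ∈ X, φ z ≤ ((γ * Real.posLog ‖z‖ + C : ℝ) : EReal)}

/-! ### Germs of analytic sets in complex `n`-space

The germ at `p` of a set `A` is its class for `=ᶠ[𝓝 p]`; inclusion of germs is `≤ᶠ[𝓝 p]`. -/

/-- The germ of `A` at `p` is an analytic germ: near `p`, the set `A` is the common zero set
of finitely many holomorphic functions. -/
def IsAnalyticGermAt {n : ℕ} (A : Set (Cn n)) (p : Cn n) : Prop :=
  ∃ (k : ℕ) (f : Fin k → Cn n → ℂ), (∀ i, AnalyticAt ℂ (f i) p) ∧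
    ∀ᶠ z in 𝓝 p, (z ∈ A ↔ ∀ i, f i z = 0)

/-- The analytic germ of `A` at `p` is irreducible: it is nonempty and is not the union of
two analytic germs both different from it. -/
def IsIrreducibleGermAt {n : ℕ} (A : Set (Cn n)) (p : Cn n) : Prop :=
  IsAnalyticGermAt A p ∧ (∃ᶠ z in 𝓝 p, z ∈ A) ∧
    ∀ B C : Set (Cn n), IsAnalyticGermAt B p → IsAnalyticGermAt C p →
      A =ᶠ[𝓝 p] (B ∪ C : Set (Cn n)) → A =ᶠ[𝓝 p] B ∨ A =ᶠ[𝓝 p] C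

/-- The germ of `Y` at `p` is an irreducible component of the germ of `A` at `p`: it is maximal
among the irreducible analytic germs contained in the germ of `A`. -/
def IsIrreducibleComponentAt {n : ℕ} (Y A : Set (Cn n)) (p : Cn n) : Prop :=
  IsIrreducibleGermAt Y p ∧ Y ≤ᶠ[𝓝 p] A ∧
    ∀ Z : Set (Cn n), IsIrreducibleGermAt Z p → Y ≤ᶠ[𝓝 p] Z → Z ≤ᶠ[𝓝 p] A → Z =ᶠ[𝓝 p] Y

/-- The germ of `A` at `p` is smooth with tangent space `T`: near `p`, the set `A` is the zero set
of a holomorphic map that vanishes at `p` and whose differential at `p` is onto with kernel `T`. -/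
def IsSmoothGermAtWithTangent {n : ℕ} (A : Set (Cn n)) (p : Cn n) (T : Submodule ℂ (Cn n)) :
    Prop :=
  ∃ (k : ℕ) (f : Cn n → Cn k), AnalyticAt ℂ f p ∧ f p = 0 ∧
    Function.Surjective (fderiv ℂ f p) ∧ (∀ v : Cn n, v ∈ T ↔ fderiv ℂ f p v = 0) ∧
    ∀ᶠ z in 𝓝 p, (z ∈ A ↔ f z = 0)

/-! ### The complex projective plane -/

/-- The complex projective plane, with homogeneous coordinates `[t : x : y]`. -/
abbrev P2 : Type := ℙ ℂ (Fin 3 → ℂ)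

/-- The quotient topology of the projective plane. -/
instance instTopologicalSpaceP2 : TopologicalSpace P2 :=
  TopologicalSpace.coinduced (Projectivization.mk' ℂ (V := Fin 3 → ℂ)) inferInstance

/-- The standard embedding `(x, y) ↦ [1 : x : y]` of the affine plane. -/
def affineEmb (z : Cn 2) : P2 :=
  Projectivization.mk ℂ ![1, z 0, z 1] (fun h => one_ne_zero (congrFun h 0))

/-- The affine chart `(t, x) ↦ [t : x : 1]` of the projective plane, centred at `[0 : 0 : 1]`. -/
def chartAtA (w : Cn 2) : P2 :=
  Projectivization.mk ℂ ![w 0, w 1, 1] (fun h => one_ne_zero (congrFun h 2))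

/-- The point `[0 : 0 : 1]`. -/
def pointA : P2 :=
  Projectivization.mk ℂ ![0, 0, 1] (fun h => one_ne_zero (congrFun h 2))

/-- `ρ(1, z) = log √(1 + ‖z‖²)`. -/
def rhoOne (z : Cn 2) : ℝ := Real.log (Real.sqrt (1 + ‖z‖ ^ 2))

/-! ### The cubic and the function -/

/-- The polynomial `x y - (x³ + 1)` in two variables. -/
def cubicPoly : MvPolynomial (Fin 2) ℂ :=
  MvPolynomial.X 0 * MvPolynomial.X 1 - (MvPolynomial.X 0 ^ 3 + 1)

/-- The affine cubic `x y = x³ + 1`. -/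
def cubic : Set (Cn 2) := {z | z 0 * z 1 = z 0 ^ 3 + 1}

/-- The projective cubic `x y t = x³ + t³` (the equation is homogeneous, so that it
does not matter which representative of a point is used). -/
def projCubic : Set P2 := {p | p.rep 1 * p.rep 2 * p.rep 0 = p.rep 1 ^ 3 + p.rep 0 ^ 3}

/-- The germ of the projective closure of the cubic at `[0 : 0 : 1]` is studied in the chart
`chartAtA`, in which the point `[0 : 0 : 1]` is the origin. -/
def cubicClosureInChart : Set (Cn 2) := chartAtA ⁻¹' closure (affineEmb '' cubic)

/-- `u(x, y) = max {-log |x|, 2 log |x| + 1}`, of interest for `x ≠ 0`. -/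
def uFun (z : Cn 2) : ℝ := max (-Real.log ‖z 0‖) (2 * Real.log ‖z 0‖ + 1)

/-- The function `u` as an extended-real function; its restriction to the cubic is `η`. -/
def eta (z : Cn 2) : EReal := (uFun z : EReal)

/-- The filter on the affine plane describing `[1 : ζ] → [0 : 0 : 1]` with `[1 : ζ]` on the set that
corresponds to `Y` in the chart `chartAtA`. -/
def alongBranch (Y : Set (Cn 2)) : Filter (Cn 2) :=
  comap affineEmb (𝓝[chartAtA '' Y] pointA)

end

/-!
Near the point at infinity, in the chart `(t, x) ↦ [t : x : 1]`, the closure of the cubic is the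
nodal cubic `x t = x³ + t³`. If `g` is the local inverse of `s ↦ s / (1 + s³)` and `h t = t * g t`,
then the substitution `x = s t` shows that in the sector `‖x‖ ≤ ‖t‖` the nodal cubic is the graph
`x = h t`, and by symmetry it is the graph `t = h x` in the other sector. These graphs are the two
branches. A graph is a holomorphic disc, so the identity theorem in one variable makes it an
irreducible germ (`isIrreducibleGermAt_coordGraph`), and the components of a union of two
irreducible germs, neither contained in the other, are these two germs. The parametrization
`s ↦ (s, s² + s⁻¹)` of the cubic identifies the filter of either branch with a punctured
neighbourhood of `0`, in the variable `s` on the first and `s⁻¹` on the second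
(`alongBranch_eq_map`), where the limits of `eta - rhoOne` are computed explicitly.

An extension `ψ` in the Lelong class of the plane would make `ψ + log ‖t‖` plurisubharmonic and
bounded above near the point at infinity, off the line `t = 0`. Such a function extends across that
line, and its value at a point is its upper limit along any holomorphic disc through the point that
is not contained in the line. As the limits along the two branches are `0` and `1`, there is no
extension. The proof does not construct the extension across the line: it compares `ψ + log ‖t‖`
with `M' + N * ‖w‖ ^ 2`, where `w = x - h t` is a defining function of the first branch, by a
maximum principle (`exists_le_of_le_on_branch`). The term `N * ‖w‖ ^ 2` has a positive Levi form, but not in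
the direction tangent to `w = const`, and the sub-mean value inequality on the complex line in that
direction is all that is needed (`not_isLocalMax_branch`). The comparison bounds the limit
along the second branch by `1 / 2`, contradicting the value `1`.
-/

/-! ### Circle means -/

theorem circleMean_mono {v w : ℂ → EReal}
    (h : ∀ θ : ℝ, v (circleMap 0 1 θ) ≤ w (circleMap 0 1 θ)) : circleMean v ≤ circleMean w := by
  unfold circleMean
  refine EReal.sub_le_sub ?_ ?_
  · refine EReal.coe_ennreal_le_coe_ennreal_iff.2 (mul_le_mul_right (lintegral_mono fun θ => ?_) _)
    exact EReal.toENNReal_le_toENNReal (h θ)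
  · refine EReal.coe_ennreal_le_coe_ennreal_iff.2 (mul_le_mul_right (lintegral_mono fun θ => ?_) _)
    exact EReal.toENNReal_le_toENNReal (EReal.neg_le_neg_iff.2 (h θ))

theorem circleMean_coe {f : ℂ → ℝ} (hf : CircleIntegrable f 0 1) :
    circleMean (fun ζ => (f ζ : EReal)) = ((Real.circleAverage f 0 1 : ℝ) : EReal) := by
  have hint : IntegrableOn (fun θ => f (circleMap 0 1 θ)) (Ioc (0 : ℝ) (2 * Real.pi)) :=
    (intervalIntegrable_iff_integrableOn_Ioc_of_le Real.two_pi_pos.le).1 hf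
  have hp : ∀ g : ℝ → ℝ, IntegrableOn g (Ioc (0 : ℝ) (2 * Real.pi)) →
      ∫⁻ θ in Ioc (0 : ℝ) (2 * Real.pi), ENNReal.ofReal (g θ) ≠ ⊤ := fun g hg =>
    (lt_of_le_of_lt (lintegral_mono fun θ => Real.ofReal_le_enorm (g θ)) hg.2).ne
  have h1 := hp _ hint
  have h2 := hp _ hint.neg
  simp only [Pi.neg_apply] at h2
  simp only [circleMean, ← EReal.coe_neg, EReal.real_coe_toENNReal]
  rw [Real.circleAverage_def, intervalIntegral.integral_of_le Real.two_pi_pos.le,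
    integral_eq_lintegral_pos_part_sub_lintegral_neg_part hint,
    ← EReal.coe_ennreal_toReal (ENNReal.mul_ne_top ENNReal.ofReal_ne_top h1),
    ← EReal.coe_ennreal_toReal (ENNReal.mul_ne_top ENNReal.ofReal_ne_top h2), ← EReal.coe_sub]
  have : (0 : ℝ) ≤ (2 * Real.pi)⁻¹ := by positivity
  rw [ENNReal.toReal_mul, ENNReal.toReal_mul, ENNReal.toReal_ofReal this, smul_eq_mul, mul_sub]

/-! ### The function on the punctured plane times the plane -/

theorem isOpen_coord_ne_zero : IsOpen {z : Cn 2 | z 0 ≠ 0} :=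
  isOpen_ne_fun (by fun_prop) continuous_const

theorem continuousOn_log_coord : ContinuousOn (fun z : Cn 2 => Real.log ‖z 0‖) {z | z 0 ≠ 0} := by
  refine ContinuousOn.log (by fun_prop) fun z hz => ?_
  exact norm_ne_zero_iff.2 hz

theorem continuousOn_uFun : ContinuousOn uFun {z : Cn 2 | z 0 ≠ 0} := by
  have := continuousOn_log_coord
  unfold uFun
  exact (this.neg).sup ((continuousOn_const.mul this).add continuousOn_const)

/-- Both functions in the maximum are affine in the pluriharmonic function `log ‖z 0‖`. -/
theorem isPsh_eta : IsPsh {z : Cn 2 | z 0 ≠ 0} eta where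
  isOpen := isOpen_coord_ne_zero
  ne_top z _ := EReal.coe_ne_top _
  exists_ne_bot := ⟨!₂[1, 0], by simp, EReal.coe_ne_bot _⟩
  usc := by
    refine ContinuousOn.upperSemicontinuousOn ?_
    exact continuous_coe_real_ereal.comp_continuousOn continuousOn_uFun
  le_circleMean z w h := by
    set l : ℂ → ℝ := fun ζ => Real.log ‖(z + ζ • w) 0‖ with hl
    have hn : ∀ ζ : ℂ, ‖ζ‖ ≤ 1 → z 0 + ζ * w 0 ≠ 0 := fun ζ hζ => by simpa using h ζ hζ
    have hharm : InnerProductSpace.HarmonicOnNhd l (Metric.closedBall 0 |1|) := fun ζ hζ => by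
      refine AnalyticAt.harmonicAt_log_norm (f := fun ζ => z 0 + ζ * w 0) (by fun_prop) (hn ζ ?_)
      simpa using hζ
    have hmean : Real.circleAverage l 0 1 = Real.log ‖z 0‖ := by
      rw [hharm.circleAverage_eq]; simp [hl]
    have hmaps : ∀ ζ ∈ Metric.sphere (0 : ℂ) |1|, z + ζ • w ∈ {z : Cn 2 | z 0 ≠ 0} := fun ζ hζ =>
      h ζ (by simpa using (mem_sphere_zero_iff_norm.1 hζ).le)
    have hci : CircleIntegrable (fun ζ => uFun (z + ζ • w)) 0 1 := by
      refine ContinuousOn.circleIntegrable' ?_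
      exact continuousOn_uFun.comp (by fun_prop) hmaps
    have hli : CircleIntegrable l 0 1 := ContinuousOn.circleIntegrable'
      (continuousOn_log_coord.comp (by fun_prop) hmaps)
    have hmn : CircleIntegrable (fun ζ => -l ζ) 0 1 := hli.neg
    have h2l : CircleIntegrable (fun ζ => 2 * l ζ) 0 1 := by
      simpa [smul_eq_mul] using! hli.const_smul (a := (2 : ℝ))
    have hc1 : CircleIntegrable (fun _ : ℂ => (1 : ℝ)) 0 1 := circleIntegrable_const _ _ _
    simp only [eta]
    rw [circleMean_coe hci, EReal.coe_le_coe_iff]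
    refine max_le ?_ ?_
    · have h1 := Real.circleAverage_mono hmn hci fun ζ _ => le_max_left _ _
      have h2 : Real.circleAverage (fun ζ => -l ζ) 0 1 = -Real.log ‖z 0‖ := by
        have := Real.circleAverage_fun_smul (a := (-1 : ℝ)) (f := l) (c := 0) (R := 1)
        simpa [hmean] using this
      exact h2 ▸ h1
    · have h1 := Real.circleAverage_mono (h2l.add hc1) hci fun ζ _ => le_max_right _ _
      have h2 : Real.circleAverage ((fun ζ => 2 * l ζ) + fun _ => 1) 0 1
          = 2 * Real.log ‖z 0‖ + 1 := by
        rw [Real.circleAverage_add h2l hc1, Real.circleAverage_const]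
        have := Real.circleAverage_fun_smul (a := (2 : ℝ)) (f := l) (c := 0) (R := 1)
        simp only [smul_eq_mul] at this
        rw [this, hmean]
      exact h2 ▸ h1

/-! ### Growth on the cubic -/

theorem mem_cubic_iff (z : Cn 2) : z ∈ cubic ↔ z 0 ≠ 0 ∧ z 1 = z 0 ^ 2 + (z 0)⁻¹ := by
  constructor
  · intro h
    have h : z 0 * z 1 = z 0 ^ 3 + 1 := h
    have h0 : z 0 ≠ 0 := fun h0 => by simp [h0] at h
    refine ⟨h0, ?_⟩
    field_simp
    linear_combination h
  · rintro ⟨h0, h⟩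
    change z 0 * z 1 = z 0 ^ 3 + 1
    rw [h]
    field_simp

/-- On the cubic `‖y‖` is at least `1 / (2 ‖x‖)` for small `x` and at least `‖x‖² / 2` for
large `x`. -/
theorem uFun_le_of_mem_cubic {z : Cn 2} (hz : z ∈ cubic) :
    uFun z ≤ Real.posLog ‖z‖ + (3 * Real.log 2 + 1) := by
  obtain ⟨h0, h1⟩ := (mem_cubic_iff z).1 hz
  have hr : 0 < ‖z 0‖ := norm_pos_iff.2 h0
  have hlog2 : 0 < Real.log 2 := Real.log_pos one_lt_two
  have hy : ‖z 1‖ ≤ ‖z‖ := PiLp.norm_apply_le z 1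
  have hpos := Real.posLog_nonneg (x := ‖z‖)
  set r := ‖z 0‖ with hrdef
  have hmul : r * ‖z 1‖ = ‖z 0 ^ 3 + 1‖ := by
    rw [hrdef, ← norm_mul, h1]; congr 1; field_simp
  -- a lower bound for `‖z‖` gives one for `log⁺ ‖z‖`
  have hle : ∀ a : ℝ, 0 < a → a ≤ 2 * ‖z 1‖ → Real.log a ≤ Real.log 2 + Real.posLog ‖z‖ := by
    intro a ha hay
    have h1 : 0 < ‖z 1‖ := by linarith
    calc Real.log a ≤ Real.log (2 * ‖z 1‖) := Real.log_le_log ha hay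
      _ = Real.log 2 + Real.log ‖z 1‖ := Real.log_mul two_ne_zero h1.ne'
      _ ≤ Real.log 2 + Real.log ‖z‖ := by gcongr
      _ ≤ Real.log 2 + Real.posLog ‖z‖ := by gcongr; exact le_max_right _ _
  refine max_le ?_ ?_
  · rcases le_or_gt (1 / 2) r with h | h
    · have : Real.log (1 / 2) ≤ Real.log r := Real.log_le_log (by norm_num) h
      rw [one_div, Real.log_inv] at this
      linarith
    · have h3 : ‖z 0 ^ 3 + 1‖ ≥ 1 - r ^ 3 := by
        have := norm_sub_norm_le (1 : ℂ) (-(z 0 ^ 3))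
        rw [norm_neg, norm_pow, norm_one, sub_neg_eq_add, add_comm 1] at this
        exact this
      have hr3 : r ^ 3 ≤ 1 / 2 := by
        calc r ^ 3 ≤ (1 / 2) ^ 3 := by gcongr
          _ ≤ 1 / 2 := by norm_num
      have := hle r⁻¹ (inv_pos.2 hr) (by
        rw [inv_le_iff_one_le_mul₀' hr]; nlinarith)
      rw [Real.log_inv] at this
      linarith
  · rcases le_or_gt r 2 with h | h
    · have : Real.log r ≤ Real.log 2 := Real.log_le_log hr h
      linarith
    · have h3 : ‖z 0 ^ 3 + 1‖ ≥ r ^ 3 - 1 := by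
        have := norm_sub_norm_le (z 0 ^ 3) (-1 : ℂ)
        rw [norm_neg, norm_pow, norm_one, sub_neg_eq_add] at this
        exact this
      have h8 : (2 : ℝ) ^ 3 ≤ r ^ 3 := by gcongr
      have := hle (r ^ 2) (by positivity) (by
        refine le_of_mul_le_mul_left ?_ hr
        nlinarith)
      rw [Real.log_pow] at this
      push_cast at this
      linarith

theorem eta_mem_lelongClass : eta ∈ LelongClass 1 cubic := by
  refine ⟨⟨⟨!₂[1, 2], ?_, EReal.coe_ne_bot _⟩, fun z hz =>
    ⟨_, eta, ((mem_cubic_iff z).1 hz).1, isPsh_eta, fun _ _ => rfl⟩⟩, 3 * Real.log 2 + 1, ?_⟩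
  · rw [mem_cubic_iff]; norm_num
  · intro z hz
    rw [one_mul]
    exact EReal.coe_le_coe_iff.2 (uFun_le_of_mem_cubic hz)

/-! ### Local properties of plurisubharmonic functions on the affine space -/

theorem IsPshOnVariety.ne_top {n : ℕ} {ψ : Cn n → EReal} (hψ : IsPshOnVariety univ ψ) (z : Cn n) :
    ψ z ≠ ⊤ := by
  obtain ⟨U, u, hz, hu, he⟩ := hψ.locally_restriction z (mem_univ z)
  rw [he z ⟨mem_univ z, hz⟩]
  exact hu.ne_top z hz

theorem IsPshOnVariety.upperSemicontinuousAt {n : ℕ} {ψ : Cn n → EReal}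
    (hψ : IsPshOnVariety univ ψ) (z : Cn n) : UpperSemicontinuousAt ψ z := by
  obtain ⟨U, u, hz, hu, he⟩ := hψ.locally_restriction z (mem_univ z)
  rw [upperSemicontinuousAt_iff]
  intro y hy
  rw [he z ⟨mem_univ z, hz⟩] at hy
  have hU := hu.isOpen.mem_nhds hz
  have h1 : ∀ᶠ x in 𝓝[U] z, u x < y := hu.usc z hz y hy
  rw [hu.isOpen.nhdsWithin_eq hz] at h1
  filter_upwards [h1, hU] with x hx hxU
  rwa [he x ⟨mem_univ x, hxU⟩]

/-- A strict form of the sub-mean value inequality: on a complex line through `p`, a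
plurisubharmonic function cannot be touched from above at `p` by a harmonic function minus
a positive multiple of `‖τ‖ ^ 2`. -/
theorem IsPshOnVariety.lt_of_eventually_le {n : ℕ} {ψ : Cn n → EReal}
    (hψ : IsPshOnVariety univ ψ) {p v : Cn n} {A : ℂ → ℂ} (hA : AnalyticAt ℂ A 0) {δ : ℝ}
    (hδ : 0 < δ)
    (h : ∀ᶠ τ : ℂ in 𝓝 0, ψ (p + τ • v) ≤ (((A τ).re - δ * ‖τ‖ ^ 2 : ℝ) : EReal)) :
    ψ p < (((A 0).re : ℝ) : EReal) := by
  obtain ⟨U, u, hz, hu, he⟩ := hψ.locally_restriction p (mem_univ p)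
  have hU : ∀ᶠ τ : ℂ in 𝓝 0, p + τ • v ∈ U := by
    have : ContinuousAt (fun τ : ℂ => p + τ • v) 0 := by fun_prop
    exact this.preimage_mem_nhds (hu.isOpen.mem_nhds (by simpa using hz))
  obtain ⟨R, hR, hball⟩ := Metric.eventually_nhds_iff_ball.1
    (h.and (hU.and hA.eventually_analyticAt))
  set ρ : ℝ := R / 2 with hρ
  have hρ0 : 0 < ρ := by positivity
  have hmem : ∀ ζ : ℂ, ‖ζ‖ ≤ 1 → (ρ : ℂ) * ζ ∈ Metric.ball (0 : ℂ) R := fun ζ hζ => by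
    rw [mem_ball_zero_iff, norm_mul, Complex.norm_real, Real.norm_of_nonneg hρ0.le]
    nlinarith [norm_nonneg ζ]
  have hsm : ∀ ζ : ℂ, p + ζ • ((ρ : ℂ) • v) = p + ((ρ : ℂ) * ζ) • v := fun ζ => by
    rw [smul_smul, mul_comm]
  set F : ℂ → ℂ := fun ζ => A (ρ * ζ) - (δ * ρ ^ 2 : ℝ) with hF
  have hharm : InnerProductSpace.HarmonicOnNhd (fun ζ => (F ζ).re)
      (Metric.closedBall 0 |1|) := fun ζ hζ => by
    have h1 : AnalyticAt ℂ A (ρ * ζ) := (hball _ (hmem ζ (by simpa using hζ))).2.2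
    have h2 : AnalyticAt ℂ (fun ζ : ℂ => A (ρ * ζ)) ζ :=
      h1.comp (g := A) (f := fun ζ : ℂ => (ρ : ℂ) * ζ) (by fun_prop)
    exact AnalyticAt.harmonicAt_re (h2.sub analyticAt_const)
  have hci : CircleIntegrable (fun ζ => (F ζ).re) 0 1 := ContinuousOn.circleIntegrable'
    (hharm.continuousOn.mono Metric.sphere_subset_closedBall)
  have hmean : u p ≤ (((F 0).re : ℝ) : EReal) := by
    have h1 := hu.le_circleMean p ((ρ : ℂ) • v) fun ζ hζ => by
      rw [hsm]; exact (hball _ (hmem ζ hζ)).2.1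
    refine h1.trans ?_
    rw [← hharm.circleAverage_eq, ← circleMean_coe hci]
    refine circleMean_mono fun θ => ?_
    have hθ : ‖circleMap 0 1 θ‖ = 1 := by simp
    obtain ⟨h2, h3, -⟩ := hball _ (hmem _ hθ.le)
    rw [hsm, ← he _ ⟨mem_univ _, h3⟩]
    refine h2.trans (EReal.coe_le_coe_iff.2 ?_)
    rw [hF, norm_mul, hθ, Complex.norm_real, Real.norm_of_nonneg hρ0.le, mul_one, Complex.sub_re,
      Complex.ofReal_re]
  rw [he p ⟨mem_univ p, hz⟩]
  refine hmean.trans_lt (EReal.coe_lt_coe_iff.2 ?_)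
  simp only [hF, mul_zero, Complex.sub_re, Complex.ofReal_re]
  have : 0 < δ * ρ ^ 2 := by positivity
  linarith

/-! ### A maximum principle along a branch at infinity -/

/-- Coordinates adapted to the curve `x' = h t` of the chart `(t, x') ↦ [t : x' : 1]`: the point of
the affine plane with chart coordinates `(t, w + h t)`. -/
noncomputable def branchCoord (h : ℂ → ℂ) (q : ℂ × ℂ) : Cn 2 := !₂[(q.2 + h q.1) / q.1, q.1⁻¹]

/-- The weight in the maximum principle.  The term `log ‖t‖` turns a function of logarithmic growth
into a function bounded near the line at infinity, `ε * log ‖t‖` makes it tend to `-∞` there,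
`N * ‖w‖ ^ 2` keeps the maximum near the curve `w = 0`, and `δ * ‖t‖ ^ 2` gives strictness. -/
noncomputable def branchWeight (ε N δ : ℝ) (q : ℂ × ℂ) : ℝ :=
  (1 + ε) * Real.log ‖q.1‖ - N * ‖q.2‖ ^ 2 + δ * ‖q.1‖ ^ 2

theorem Complex.sq_norm_add (a b : ℂ) :
    ‖a + b‖ ^ 2 = ‖a‖ ^ 2 + 2 * ((starRingEnd ℂ) a * b).re + ‖b‖ ^ 2 := by
  simp only [Complex.sq_norm, Complex.normSq_apply, Complex.add_re, Complex.add_im,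
    Complex.mul_re, Complex.conj_re, Complex.conj_im]
  ring

/-- The weighted function has no local maximum.  The direction of the line used is that of
the curve `w = const` through the point; along it, `w` is constant to first order, so
the Levi form of `N * ‖w‖ ^ 2` vanishes, whatever the size of `N`. -/
theorem not_isLocalMax_branch {ψ : Cn 2 → EReal} (hψ : IsPshOnVariety univ ψ) {h : ℂ → ℂ}
    {ε N δ : ℝ} (hN : 0 ≤ N) (hδ : 0 < δ) {t₀ w₀ : ℂ} (ht₀ : t₀ ≠ 0) (hh : AnalyticAt ℂ h t₀)
    {a : ℝ} (ha : ψ (branchCoord h (t₀, w₀)) = a)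
    (hmax : ∀ᶠ q in 𝓝 (t₀, w₀), ψ (branchCoord h q) ≤
      ((a + branchWeight ε N δ (t₀, w₀) - branchWeight ε N δ q : ℝ) : EReal)) : False := by
  set X₀ : ℂ := (w₀ + h t₀) / t₀ with hX₀
  set V₀ : ℂ := deriv h t₀ / t₀ - X₀ / t₀ with hV₀
  -- the coordinates `t` and `w` of the point with parameter `τ` of the line; `V₀` is chosen so that
  -- `w` has derivative `0` at `τ = 0`
  set t : ℂ → ℂ := fun τ => t₀ ^ 2 / (t₀ - τ) with ht
  set w : ℂ → ℂ := fun τ => t τ * (X₀ + τ * V₀) - h (t τ) with hw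
  have hne : ∀ᶠ τ : ℂ in 𝓝 0, t₀ - τ ≠ 0 := by
    have : ContinuousAt (fun τ : ℂ => t₀ - τ) 0 := by fun_prop
    exact this.eventually_ne (by simpa using ht₀)
  have htan : AnalyticAt ℂ t 0 :=
    analyticAt_const.div (by fun_prop) (by simpa using ht₀)
  have ht0 : t 0 = t₀ := by simp only [ht, sub_zero]; field_simp
  have hw0 : w 0 = w₀ := by simp only [hw, ht0, hX₀]; field_simp; ring
  have hwan : AnalyticAt ℂ w 0 := by
    have : AnalyticAt ℂ (fun τ => h (t τ)) 0 := AnalyticAt.comp (g := h) (by rwa [ht0]) htan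
    exact (htan.mul (by fun_prop)).sub this
  have htd : HasDerivAt t 1 0 := by
    have h1 : HasDerivAt (fun τ : ℂ => t₀ - τ) (-1) 0 := by
      simpa using! (hasDerivAt_id (0 : ℂ)).const_sub t₀
    have h2 := (h1.inv (by simpa using ht₀)).const_mul (t₀ ^ 2)
    refine (h2.congr_deriv ?_).congr_of_eventuallyEq (Eventually.of_forall fun τ => ?_)
    · simp only [sub_zero]; field_simp
    · simp [ht, div_eq_mul_inv]
  have hwd : HasDerivAt w 0 0 := by
    have h1 : HasDerivAt (fun τ : ℂ => X₀ + τ * V₀) V₀ 0 := by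
      simpa using! ((hasDerivAt_id (0 : ℂ)).mul_const V₀).const_add X₀
    have h2 : HasDerivAt (fun τ => h (t τ)) (deriv h t₀) 0 := by
      have h3 : HasDerivAt h (deriv h t₀) (t 0) := by
        rw [ht0]; exact hh.differentiableAt.hasDerivAt
      simpa using! h3.comp (0 : ℂ) htd
    refine ((htd.mul h1).sub h2).congr_deriv ?_
    rw [ht0, hV₀]; field_simp; ring
  -- the increments of `w` and `t`
  have hk : ∀ᶠ τ : ℂ in 𝓝 0, N * ‖w τ - w₀‖ ^ 2 ≤ δ / 8 * ‖τ‖ ^ 2 := by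
    have hlo := hasDerivAt_iff_isLittleO.1 hwd
    simp only [hw0, smul_zero, sub_zero] at hlo
    set c : ℝ := Real.sqrt (δ / (8 * (N + 1))) with hc
    have hc2 : c ^ 2 = δ / (8 * (N + 1)) := Real.sq_sqrt (by positivity)
    have hcpos : 0 < c := Real.sqrt_pos.2 (by positivity)
    filter_upwards [hlo.def hcpos] with τ hτ
    have h1 : ‖w τ - w₀‖ ^ 2 ≤ c ^ 2 * ‖τ‖ ^ 2 := by rw [← mul_pow]; gcongr
    have h2 : N * c ^ 2 ≤ δ / 8 := by
      rw [hc2, ← mul_div_assoc, div_le_div_iff₀ (by positivity) (by norm_num)]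
      nlinarith
    calc N * ‖w τ - w₀‖ ^ 2 ≤ N * (c ^ 2 * ‖τ‖ ^ 2) := by gcongr
      _ = N * c ^ 2 * ‖τ‖ ^ 2 := by ring
      _ ≤ δ / 8 * ‖τ‖ ^ 2 := by gcongr
  have hm : ∀ᶠ τ : ℂ in 𝓝 0, ‖τ‖ ^ 2 / 4 ≤ ‖t τ - t₀‖ ^ 2 := by
    have hlt : ∀ᶠ τ : ℂ in 𝓝 0, ‖t₀ - τ‖ < 2 * ‖t₀‖ := by
      have : ContinuousAt (fun τ : ℂ => ‖t₀ - τ‖) 0 := by fun_prop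
      refine this.eventually_lt continuousAt_const ?_
      have := norm_pos_iff.2 ht₀
      simp only [sub_zero]; linarith
    filter_upwards [hne, hlt] with τ h1 h2
    have h3 : t τ - t₀ = t₀ * τ / (t₀ - τ) := by simp only [ht]; field_simp; ring
    have h4 : ‖τ‖ / 2 ≤ ‖t τ - t₀‖ := by
      rw [h3, norm_div, norm_mul, div_le_div_iff₀ two_pos (norm_pos_iff.2 h1)]
      nlinarith [norm_nonneg τ]
    calc ‖τ‖ ^ 2 / 4 = (‖τ‖ / 2) ^ 2 := by ring
      _ ≤ _ := by gcongr
  -- the real part of `A` is the pluriharmonic part of the bound `hmax` on the line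
  set A : ℂ → ℂ := fun τ => (a : ℂ) + (1 + ε : ℝ) * Complex.log (1 - τ / t₀)
    + 2 * (N : ℂ) * ((starRingEnd ℂ) w₀ * (w τ - w₀))
    - 2 * (δ : ℂ) * ((starRingEnd ℂ) t₀ * (t τ - t₀)) with hA
  have hAan : AnalyticAt ℂ A 0 := by
    have h1 : AnalyticAt ℂ (fun τ : ℂ => Complex.log (1 - τ / t₀)) 0 :=
      AnalyticAt.clog (by fun_prop) (by simp)
    have h2 : AnalyticAt ℂ (fun τ => w τ - w₀) 0 := hwan.sub analyticAt_const
    have h3 : AnalyticAt ℂ (fun τ => t τ - t₀) 0 := htan.sub analyticAt_const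
    exact ((analyticAt_const.add (analyticAt_const.mul h1)).add
      (analyticAt_const.mul (analyticAt_const.mul h2))).sub
      (analyticAt_const.mul (analyticAt_const.mul h3))
  have hA0 : (A 0).re = a := by simp [hA, ht0, hw0]
  have hAre : ∀ τ, (A τ).re = a + (1 + ε) * Real.log ‖1 - τ / t₀‖
      + 2 * N * ((starRingEnd ℂ) w₀ * (w τ - w₀)).re
      - 2 * δ * ((starRingEnd ℂ) t₀ * (t τ - t₀)).re := fun τ => by
    have e1 : ∀ (x : ℝ) (z : ℂ), (2 * (x : ℂ) * z).re = 2 * x * z.re := fun x z => by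
      rw [show (2 * (x : ℂ)) = ((2 * x : ℝ) : ℂ) by push_cast; ring, Complex.re_ofReal_mul]
    simp only [hA, Complex.add_re, Complex.sub_re, Complex.ofReal_re, Complex.re_ofReal_mul, e1,
      Complex.log_re]
  have hcont : Tendsto (fun τ => (t τ, w τ)) (𝓝 0) (𝓝 (t₀, w₀)) := by
    have := htan.continuousAt.prodMk hwan.continuousAt
    simpa only [ContinuousAt, ht0, hw0] using this
  have hlt := hψ.lt_of_eventually_le (p := branchCoord h (t₀, w₀))
    (v := !₂[V₀, -(t₀ ^ 2)⁻¹]) hAan (show 0 < δ / 8 by positivity) (by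
      filter_upwards [hcont.eventually hmax, hne, hk, hm] with τ h1 h2 h3 h4
      have hpt : branchCoord h (t₀, w₀) + τ • !₂[V₀, -(t₀ ^ 2)⁻¹] = branchCoord h (t τ, w τ) := by
        have htτ : t τ ≠ 0 := div_ne_zero (pow_ne_zero 2 ht₀) h2
        ext i
        fin_cases i
        · have : (w τ + h (t τ)) / t τ = X₀ + τ * V₀ := by
            rw [hw]; field_simp; ring
          simp [branchCoord, this, hX₀]
        · simp only [branchCoord, ht]
          simp
          field_simp
          ring
      rw [hpt]
      refine h1.trans (EReal.coe_le_coe_iff.2 ?_)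
      have e1 := Complex.sq_norm_add w₀ (w τ - w₀)
      have e2 := Complex.sq_norm_add t₀ (t τ - t₀)
      have e3 : Real.log ‖t τ‖ = Real.log ‖t₀‖ - Real.log ‖1 - τ / t₀‖ := by
        have h5 : 1 - τ / t₀ ≠ 0 := by
          intro h6; apply h2; field_simp at h6; simpa using h6
        rw [← Real.log_div (norm_ne_zero_iff.2 ht₀) (norm_ne_zero_iff.2 h5), ← norm_div]
        congr 2
        simp only [ht]; field_simp
      rw [add_sub_cancel] at e1 e2
      rw [hAre]
      simp only [branchWeight, e1, e2, e3]
      nlinarith)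
  rw [ha, hA0] at hlt
  exact lt_irrefl _ hlt

theorem continuousAt_branchCoord {h : ℂ → ℂ} {q : ℂ × ℂ} (hq : q.1 ≠ 0)
    (hh : ContinuousAt h q.1) : ContinuousAt (branchCoord h) q := by
  have h1 : ContinuousAt (fun q : ℂ × ℂ => h q.1) q :=
    ContinuousAt.comp (g := h) (f := Prod.fst) hh continuousAt_fst
  have h2 : ContinuousAt (fun q : ℂ × ℂ => (q.2 + h q.1) / q.1) q :=
    (continuousAt_snd.add h1).div continuousAt_fst hq
  have h3 : ContinuousAt (fun q : ℂ × ℂ => q.1⁻¹) q := continuousAt_fst.inv₀ hq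
  refine (PiLp.continuous_toLp 2 _).continuousAt.comp (continuousAt_pi.2 fun i => ?_)
  fin_cases i
  · simpa using! h2
  · simpa using! h3

theorem continuousAt_branchWeight {ε N δ : ℝ} {q : ℂ × ℂ} (hq : q.1 ≠ 0) :
    ContinuousAt (branchWeight ε N δ) q := by
  have h1 : ContinuousAt (fun q : ℂ × ℂ => Real.log ‖q.1‖) q :=
    ContinuousAt.log (by fun_prop) (norm_ne_zero_iff.2 hq)
  unfold branchWeight
  fun_prop

theorem posLog_norm_branchCoord_le {h : ℂ → ℂ} {t w : ℂ} {T : ℝ} (ht : t ≠ 0) (ht1 : ‖t‖ ≤ 1)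
    (hT : ‖w + h t‖ + 1 ≤ T) :
    Real.posLog ‖branchCoord h (t, w)‖ ≤ Real.log T - Real.log ‖t‖ := by
  have htp : 0 < ‖t‖ := norm_pos_iff.2 ht
  have hT1 : 1 ≤ T := by linarith [norm_nonneg (w + h t)]
  have hnorm : ‖branchCoord h (t, w)‖ ≤ T / ‖t‖ := by
    have h1 : ‖branchCoord h (t, w)‖ ≤ ‖(w + h t) / t‖ + ‖t⁻¹‖ := by
      rw [EuclideanSpace.norm_eq, Real.sqrt_le_iff]
      refine ⟨by positivity, ?_⟩
      simp only [Fin.sum_univ_two, branchCoord, PiLp.toLp_apply, Matrix.cons_val_zero,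
        Matrix.cons_val_one]
      nlinarith [norm_nonneg ((w + h t) / t), norm_nonneg t⁻¹]
    refine h1.trans ?_
    rw [norm_div, norm_inv, inv_eq_one_div, ← add_div]
    gcongr
  have h1T : 1 ≤ T / ‖t‖ := (one_le_div htp).2 (ht1.trans hT1)
  calc Real.posLog ‖branchCoord h (t, w)‖ ≤ Real.posLog (T / ‖t‖) :=
        Real.posLog_le_posLog (norm_nonneg _) hnorm
    _ = Real.log (T / ‖t‖) := Real.posLog_eq_log (by rwa [abs_of_nonneg (by positivity)])
    _ = Real.log T - Real.log ‖t‖ := Real.log_div (by positivity) htp.ne'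

/-- If a function of the Lelong class is at most `M + log (1 / ‖t‖)` on the branch `w = 0`, then it
is at most `M' + log (1 / ‖t‖) + N * ‖w‖ ^ 2` in a full neighbourhood of the end of the branch.
This is what is needed of the fact that `ψ + log ‖t‖` extends to a plurisubharmonic function across
the line at infinity, whose value at a point is its upper limit along any branch. -/
theorem exists_le_of_le_on_branch {ψ : Cn 2 → EReal} (hψ : ψ ∈ LelongClass 1 univ) {h : ℂ → ℂ}
    {R M M' : ℝ} (hR : 0 < R) (hh : ∀ t, ‖t‖ < R → AnalyticAt ℂ h t) (hM : M < M')
    (hb : ∀ t, t ≠ 0 → ‖t‖ < R →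
      ψ (branchCoord h (t, 0)) ≤ ((M - Real.log ‖t‖ : ℝ) : EReal)) :
    ∃ N r r' : ℝ, 0 < r ∧ 0 < r' ∧ ∀ t w : ℂ, t ≠ 0 → ‖t‖ < r → ‖w‖ ≤ r' →
      ψ (branchCoord h (t, w)) ≤ ((M' + N * ‖w‖ ^ 2 - Real.log ‖t‖ : ℝ) : EReal) := by
  obtain ⟨hpsh, C, hC⟩ := hψ
  set r : ℝ := min (R / 2) 1 with hr
  have hr0 : 0 < r := by positivity
  have hr1 : r ≤ 1 := min_le_right _ _
  have hrR : r < R := (min_le_left _ _).trans_lt (half_lt_self hR)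
  have husc : ∀ q : ℂ × ℂ, q.1 ≠ 0 → ‖q.1‖ < R →
      UpperSemicontinuousAt (fun q => ψ (branchCoord h q)) q := fun q hq hqR =>
    (hpsh.upperSemicontinuousAt _).comp (continuousAt_branchCoord hq (hh _ hqR).continuousAt)
  -- a tube around the part of the branch over the circle `‖t‖ = r`
  have htube : ∀ᶠ w : ℂ in 𝓝 0, ∀ t ∈ Metric.sphere (0 : ℂ) r,
      ψ (branchCoord h (t, w)) < ((M' - Real.log r : ℝ) : EReal) := by
    refine (isCompact_sphere (0 : ℂ) r).eventually_forall_of_forall_eventually fun t ht => ?_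
    have ht' : ‖t‖ = r := mem_sphere_zero_iff_norm.1 ht
    have ht0 : t ≠ 0 := norm_pos_iff.1 (ht' ▸ hr0)
    have h1 : ψ (branchCoord h (t, 0)) < ((M' - Real.log r : ℝ) : EReal) := by
      refine (hb t ht0 (ht' ▸ hrR)).trans_lt (EReal.coe_lt_coe_iff.2 ?_)
      rw [ht']; linarith
    have h2 := husc (t, 0) ht0 (ht' ▸ hrR) _ h1
    exact (continuous_swap.tendsto ((0 : ℂ), t)).eventually h2
  obtain ⟨s, hs, hball⟩ := Metric.eventually_nhds_iff_ball.1 htube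
  set r' : ℝ := min (s / 2) 1 with hr'
  have hr'0 : 0 < r' := by positivity
  have hr's : r' < s := (min_le_left _ _).trans_lt (half_lt_self hs)
  -- an upper bound for `ψ + log ‖t‖` near the end of the branch
  obtain ⟨H, hH⟩ : ∃ H, ∀ t ∈ Metric.closedBall (0 : ℂ) r, ‖h t‖ ≤ H :=
    (isCompact_closedBall 0 r).exists_bound_of_continuousOn fun t ht =>
      (hh t ((mem_closedBall_zero_iff.1 ht).trans_lt hrR)).continuousAt.continuousWithinAt
  set C' : ℝ := Real.log (H + 2) + C with hC'
  have hupper : ∀ t w : ℂ, t ≠ 0 → ‖t‖ ≤ r → ‖w‖ ≤ r' →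
      ψ (branchCoord h (t, w)) ≤ ((C' - Real.log ‖t‖ : ℝ) : EReal) := by
    intro t w ht htr hw
    refine (hC _ (mem_univ _)).trans (EReal.coe_le_coe_iff.2 ?_)
    have := posLog_norm_branchCoord_le (h := h) (w := w) (T := H + 2) ht (htr.trans hr1) (by
      have h1 := norm_add_le w (h t)
      have h2 := hH t (mem_closedBall_zero_iff.2 htr)
      have h3 : r' ≤ 1 := min_le_right _ _
      linarith)
    linarith
  set N : ℝ := |C' - M'| / r' ^ 2 with hN
  have hN0 : 0 ≤ N := by positivity
  have hNr : C' ≤ M' + N * r' ^ 2 := by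
    rw [hN, div_mul_cancel₀ _ (by positivity)]
    linarith [le_abs_self (C' - M')]
  refine ⟨N, r, r', hr0, hr'0, fun t₁ w₁ ht₁ ht₁r hw₁ => ?_⟩
  by_contra! hcon
  have ht₁p : 0 < ‖t₁‖ := norm_pos_iff.2 ht₁
  -- the parameters of the weight, chosen after the excess `e` at the point `(t₁, w₁)`
  obtain ⟨a₁, ha₁⟩ : ∃ a₁ : ℝ, ψ (branchCoord h (t₁, w₁)) = a₁ :=
    ⟨_, (EReal.coe_toReal (hpsh.ne_top _) (ne_bot_of_gt hcon)).symm⟩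
  rw [ha₁, EReal.coe_lt_coe_iff] at hcon
  set e : ℝ := a₁ - (M' + N * ‖w₁‖ ^ 2 - Real.log ‖t₁‖) with he
  have he0 : 0 < e := sub_pos.2 hcon
  have hlogr : Real.log ‖t₁‖ ≤ Real.log r := Real.log_le_log ht₁p ht₁r.le
  set D : ℝ := r ^ 2 + (Real.log r - Real.log ‖t₁‖) + 1 with hD
  have hD0 : 0 < D := by nlinarith
  set ε : ℝ := e / (2 * D) with hε
  have hε0 : 0 < ε := by positivity
  have hεD : ε * D = e / 2 := by rw [hε]; field_simp
  set B := branchWeight ε N ε with hB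
  set L : ℝ := M' + ε * Real.log r + ε * r ^ 2 with hL
  have hstart : L < a₁ + B (t₁, w₁) := by
    simp only [hL, hB, branchWeight]
    have : 0 ≤ ε * ‖t₁‖ ^ 2 := by positivity
    have : a₁ = e + (M' + N * ‖w₁‖ ^ 2 - Real.log ‖t₁‖) := by rw [he]; ring
    nlinarith
  -- an inner radius so small that the logarithmic term dominates there
  set η : ℝ := min (‖t₁‖ / 2) (Real.exp ((M' - C') / ε + Real.log r)) with hη
  have hη0 : 0 < η := lt_min (by positivity) (Real.exp_pos _)
  have hηt : η < ‖t₁‖ := (min_le_left _ _).trans_lt (half_lt_self ht₁p)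
  have hηlog : C' + ε * Real.log η ≤ M' + ε * Real.log r := by
    have h1 : Real.log η ≤ (M' - C') / ε + Real.log r := by
      have := Real.log_le_log hη0 (min_le_right (‖t₁‖ / 2) (Real.exp ((M' - C') / ε + Real.log r)))
      rwa [Real.log_exp] at this
    have h2 := mul_le_mul_of_nonneg_left h1 hε0.le
    rw [mul_add, mul_div_cancel₀ _ hε0.ne'] at h2
    linarith
  set K : Set (ℂ × ℂ) :=
    (Metric.closedBall 0 r ∩ {t | η ≤ ‖t‖}) ×ˢ Metric.closedBall 0 r' with hK
  have hKc : IsCompact K := ((isCompact_closedBall _ _).inter_right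
    (isClosed_le continuous_const continuous_norm)).prod (isCompact_closedBall _ _)
  have hKmem : ∀ t w : ℂ, (t, w) ∈ K ↔ (‖t‖ ≤ r ∧ η ≤ ‖t‖) ∧ ‖w‖ ≤ r' := fun t w => by
    simp [hK]
  have h1K : (t₁, w₁) ∈ K := (hKmem _ _).2 ⟨⟨ht₁r.le, hηt.le⟩, hw₁⟩
  have hKusc : UpperSemicontinuousOn (fun q => ψ (branchCoord h q) + (B q : EReal)) K := by
    rintro ⟨t, w⟩ hq
    obtain ⟨⟨hq1, hq2⟩, hq3⟩ := (hKmem _ _).1 hq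
    have hq0 : t ≠ 0 := norm_pos_iff.1 (hη0.trans_le hq2)
    refine UpperSemicontinuousAt.upperSemicontinuousWithinAt _ ?_
    refine UpperSemicontinuousAt.add' (husc (t, w) hq0 (hq1.trans_lt hrR)) ?_
      (EReal.continuousAt_add (Or.inr (EReal.coe_ne_bot _)) (Or.inr (EReal.coe_ne_top _)))
    exact ContinuousAt.upperSemicontinuousAt
      (continuous_coe_real_ereal.continuousAt.comp (continuousAt_branchWeight hq0))
  obtain ⟨⟨t₀, w₀⟩, h0K, hmax⟩ := hKusc.exists_isMaxOn ⟨_, h1K⟩ hKc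
  have hge := hmax h1K
  simp only [ha₁, mem_ofPred_eq] at hge
  obtain ⟨a, ha⟩ : ∃ a : ℝ, ψ (branchCoord h (t₀, w₀)) = a := by
    refine ⟨_, (EReal.coe_toReal (hpsh.ne_top _) fun hbot => ?_).symm⟩
    rw [hbot, EReal.bot_add, ← EReal.coe_add] at hge
    exact absurd (le_bot_iff.1 hge) (EReal.coe_ne_bot _)
  rw [ha, ← EReal.coe_add, ← EReal.coe_add, EReal.coe_le_coe_iff] at hge
  obtain ⟨⟨h01, h02⟩, h03⟩ := (hKmem _ _).1 h0K
  have ht₀p : 0 < ‖t₀‖ := hη0.trans_le h02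
  have ht₀ : t₀ ≠ 0 := norm_pos_iff.1 ht₀p
  have haC : a ≤ C' - Real.log ‖t₀‖ := by
    have := hupper t₀ w₀ ht₀ h01 h03
    rwa [ha, EReal.coe_le_coe_iff] at this
  have hval : B (t₀, w₀) = (1 + ε) * Real.log ‖t₀‖ - N * ‖w₀‖ ^ 2 + ε * ‖t₀‖ ^ 2 := rfl
  have hsq : ε * ‖t₀‖ ^ 2 ≤ ε * r ^ 2 := by gcongr
  have hNw : 0 ≤ N * ‖w₀‖ ^ 2 := by positivity
  have hlog0 : ε * Real.log ‖t₀‖ ≤ ε * Real.log r := by gcongr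
  -- the maximum is not attained on the boundary
  have hi1 : ‖t₀‖ < r := by
    refine lt_of_le_of_ne h01 fun heq => ?_
    have := hball w₀ (by rw [mem_ball_zero_iff]; exact h03.trans_lt hr's) t₀
      (mem_sphere_zero_iff_norm.2 heq)
    rw [ha, EReal.coe_lt_coe_iff, ← heq] at this
    linarith
  have hi2 : η < ‖t₀‖ := by
    refine lt_of_le_of_ne h02 fun heq => ?_
    rw [heq] at hηlog
    linarith
  have hi3 : ‖w₀‖ < r' := by
    refine lt_of_le_of_ne h03 fun heq => ?_
    rw [heq] at hval
    linarith
  have hint : ∀ᶠ q in 𝓝 (t₀, w₀), q ∈ K := by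
    have e1 : ∀ᶠ q : ℂ × ℂ in 𝓝 (t₀, w₀), ‖q.1‖ < r :=
      (by fun_prop : ContinuousAt (fun q : ℂ × ℂ => ‖q.1‖) (t₀, w₀)).eventually_lt
        continuousAt_const hi1
    have e2 : ∀ᶠ q : ℂ × ℂ in 𝓝 (t₀, w₀), η < ‖q.1‖ :=
      continuousAt_const.eventually_lt
        (by fun_prop : ContinuousAt (fun q : ℂ × ℂ => ‖q.1‖) (t₀, w₀)) hi2
    have e3 : ∀ᶠ q : ℂ × ℂ in 𝓝 (t₀, w₀), ‖q.2‖ < r' :=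
      (by fun_prop : ContinuousAt (fun q : ℂ × ℂ => ‖q.2‖) (t₀, w₀)).eventually_lt
        continuousAt_const hi3
    filter_upwards [e1, e2, e3] with q q1 q2 q3
    exact (hKmem q.1 q.2).2 ⟨⟨q1.le, q2.le⟩, q3.le⟩
  refine not_isLocalMax_branch hpsh hN0 hε0 ht₀ (hh t₀ (h01.trans_lt hrR)) (ε := ε) ha ?_
  filter_upwards [hint] with q hq
  have h1 := hmax hq
  simp only [ha, mem_ofPred_eq] at h1
  rw [EReal.coe_sub, EReal.coe_add]
  exact EReal.le_sub_iff_add_le (Or.inl (EReal.coe_ne_bot _)) (Or.inl (EReal.coe_ne_top _)) |>.2 h1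

/-! ### Irreducible components of analytic germs -/

section Germs

variable {n : ℕ} {p : Cn n}

theorem IsAnalyticGermAt.inter {A B : Set (Cn n)} (hA : IsAnalyticGermAt A p)
    (hB : IsAnalyticGermAt B p) : IsAnalyticGermAt (A ∩ B) p := by
  obtain ⟨k, f, hf, hf'⟩ := hA
  obtain ⟨l, g, hg, hg'⟩ := hB
  refine ⟨k + l, Fin.append f g, fun i => ?_, ?_⟩
  · refine Fin.addCases (fun i => ?_) (fun i => ?_) i
    · rw [Fin.append_left]; exact hf i
    · rw [Fin.append_right]; exact hg i
  · filter_upwards [hf', hg'] with z h1 h2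
    rw [mem_inter_iff, h1, h2]
    constructor
    · rintro ⟨h3, h4⟩ i
      refine Fin.addCases (fun i => ?_) (fun i => ?_) i
      · rw [Fin.append_left]; exact h3 i
      · rw [Fin.append_right]; exact h4 i
    · intro h
      exact ⟨fun i => by simpa using h (Fin.castAdd l i),
        fun i => by simpa using h (Fin.natAdd k i)⟩

/-- The identity theorem on a holomorphic curve: its germ lies in a given analytic germ or meets it
at most in the base point. -/
theorem IsAnalyticGermAt.eventually_mem_or_eventually_notMem {A : Set (Cn n)}
    (hA : IsAnalyticGermAt A p) {γ : ℂ → Cn n} (hγ : AnalyticAt ℂ γ 0) (h0 : γ 0 = p) :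
    (∀ᶠ t in 𝓝 0, γ t ∈ A) ∨ ∀ᶠ t in 𝓝[≠] 0, γ t ∉ A := by
  obtain ⟨k, f, hf, hA⟩ := hA
  have hA' : ∀ᶠ t in 𝓝 0, (γ t ∈ A ↔ ∀ i, f i (γ t) = 0) := by
    have : Tendsto γ (𝓝 0) (𝓝 p) := h0 ▸ hγ.continuousAt.tendsto
    exact this.eventually hA
  have hfγ : ∀ i, AnalyticAt ℂ (fun t => f i (γ t)) 0 := fun i =>
    AnalyticAt.comp (g := f i) (h0 ▸ hf i) hγ
  by_cases h : ∀ i, ∀ᶠ t in 𝓝 0, f i (γ t) = 0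
  · left
    filter_upwards [hA', eventually_all.2 h] with t h1 h2
    exact h1.2 h2
  · right
    push Not at h
    obtain ⟨i, hi⟩ := h
    have := (hfγ i).eventually_eq_zero_or_eventually_ne_zero.resolve_left (by rwa [not_eventually])
    filter_upwards [this, hA'.filter_mono nhdsWithin_le_nhds] with t h1 h2 h3
    exact h1 (h2.1 h3 i)

theorem IsIrreducibleGermAt.le_or_le {A B Z : Set (Cn n)} (hZ : IsIrreducibleGermAt Z p)
    (hA : IsAnalyticGermAt A p) (hB : IsAnalyticGermAt B p)
    (h : Z ≤ᶠ[𝓝 p] (A ∪ B : Set (Cn n))) : Z ≤ᶠ[𝓝 p] A ∨ Z ≤ᶠ[𝓝 p] B := by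
  have h' : ∀ᶠ z in 𝓝 p, z ∈ Z → z ∈ A ∪ B := h
  have heq : Z =ᶠ[𝓝 p] (Z ∩ A ∪ Z ∩ B : Set (Cn n)) := by
    refine eventuallyEq_set.2 ?_
    filter_upwards [h'] with z hz
    rw [← inter_union_distrib_left]
    exact ⟨fun h1 => ⟨h1, hz h1⟩, fun h1 => h1.1⟩
  refine (hZ.2.2 _ _ (hZ.1.inter hA) (hZ.1.inter hB) heq).imp (fun h => ?_) (fun h => ?_)
  all_goals
    have h1 := eventuallyEq_set.1 h
    exact h1.mono fun z hz hzZ => (hz.1 hzZ).2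

theorem isIrreducibleComponentAt_of_eq_union {X₁ X₂ A : Set (Cn n)}
    (h₁ : IsIrreducibleGermAt X₁ p) (h₂ : IsIrreducibleGermAt X₂ p)
    (hA : A =ᶠ[𝓝 p] (X₁ ∪ X₂ : Set (Cn n))) (h₁₂ : ¬ X₁ ≤ᶠ[𝓝 p] X₂) :
    IsIrreducibleComponentAt X₁ A p := by
  refine ⟨h₁, EventuallyLE.trans_eq (.of_forall fun z (hz : z ∈ X₁) => Or.inl hz) hA.symm,
    fun Z hZ h1 h2 => ?_⟩
  rcases hZ.le_or_le h₁.1 h₂.1 (h2.trans_eq hA) with h | h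
  · exact h.antisymm h1
  · exact absurd (h1.trans h) h₁₂

theorem IsIrreducibleComponentAt.eq_or_eq_of_eq_union {X₁ X₂ A Y : Set (Cn n)}
    (hY : IsIrreducibleComponentAt Y A p) (h₁ : IsIrreducibleGermAt X₁ p)
    (h₂ : IsIrreducibleGermAt X₂ p) (hA : A =ᶠ[𝓝 p] (X₁ ∪ X₂ : Set (Cn n))) :
    Y =ᶠ[𝓝 p] X₁ ∨ Y =ᶠ[𝓝 p] X₂ := by
  refine (hY.1.le_or_le h₁.1 h₂.1 (hY.2.1.trans_eq hA)).imp (fun h => ?_) (fun h => ?_)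
  · exact (hY.2.2 _ h₁ h
      (EventuallyLE.trans_eq (.of_forall fun z (hz : z ∈ X₁) => Or.inl hz) hA.symm)).symm
  · exact (hY.2.2 _ h₂ h
      (EventuallyLE.trans_eq (.of_forall fun z (hz : z ∈ X₂) => Or.inr hz) hA.symm)).symm

end Germs

/-! ### Graphs in the plane -/

/-- The graph `z j = h (z i)` in the plane with coordinates `z i` and `z j`. -/
def coordGraph (i j : Fin 2) (h : ℂ → ℂ) : Set (Cn 2) := {z | z j = h (z i)}

/-- The parametrization of `coordGraph i j h` by the coordinate `z i`. -/
noncomputable def graphMap (i j : Fin 2) (h : ℂ → ℂ) (t : ℂ) : Cn 2 :=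
  t • EuclideanSpace.single i 1 + h t • EuclideanSpace.single j 1

section Graph

variable {i j : Fin 2} {h : ℂ → ℂ}

theorem graphMap_apply_left (hij : i ≠ j) (t : ℂ) : graphMap i j h t i = t := by
  simp [graphMap, hij]

theorem graphMap_apply_right (hij : i ≠ j) (t : ℂ) : graphMap i j h t j = h t := by
  simp [graphMap, hij.symm]

theorem graphMap_mem (hij : i ≠ j) (t : ℂ) : graphMap i j h t ∈ coordGraph i j h := by
  change _ = h _
  rw [graphMap_apply_left hij, graphMap_apply_right hij]

theorem graphMap_of_mem (hij : i ≠ j) {z : Cn 2} (hz : z ∈ coordGraph i j h) :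
    graphMap i j h (z i) = z := by
  have hz : z j = h (z i) := hz
  ext k
  rcases (show k = i ∨ k = j by omega) with rfl | rfl
  · rw [graphMap_apply_left hij]
  · rw [graphMap_apply_right hij, hz]

theorem graphMap_zero (h0 : h 0 = 0) : graphMap i j h 0 = 0 := by simp [graphMap, h0]

theorem analyticAt_graphMap (hh : AnalyticAt ℂ h 0) : AnalyticAt ℂ (graphMap i j h) 0 :=
  (analyticAt_id.smul analyticAt_const).add (hh.smul analyticAt_const)

theorem analyticAt_graphEquation (hh : AnalyticAt ℂ h 0) :
    AnalyticAt ℂ (fun z : Cn 2 => z j - h (z i)) 0 := by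
  have hp : ∀ k : Fin 2, AnalyticAt ℂ (fun z : Cn 2 => z k) 0 := fun k =>
    (EuclideanSpace.proj k : Cn 2 →L[ℂ] ℂ).analyticAt 0
  exact (hp j).sub (AnalyticAt.comp (g := h) (by simpa using hh) (hp i))

theorem isIrreducibleGermAt_coordGraph (hij : i ≠ j) (hh : AnalyticAt ℂ h 0) (h0 : h 0 = 0) :
    IsIrreducibleGermAt (coordGraph i j h) 0 := by
  have hanalytic : IsAnalyticGermAt (coordGraph i j h) 0 :=
    ⟨1, fun _ z => z j - h (z i), fun _ => analyticAt_graphEquation hh,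
      Eventually.of_forall fun z => by simp [coordGraph, sub_eq_zero]⟩
  have hγ := analyticAt_graphMap (i := i) (j := j) hh
  have hγ0 : graphMap i j h 0 = 0 := graphMap_zero h0
  -- a germ containing the image of the parametrization contains the graph
  have key : ∀ B C : Set (Cn 2), coordGraph i j h =ᶠ[𝓝 0] (B ∪ C : Set (Cn 2)) →
      (∀ᶠ t in 𝓝 0, graphMap i j h t ∈ B) → coordGraph i j h =ᶠ[𝓝 0] B := by
    intro B C hBC hB
    have hi : Tendsto (fun z : Cn 2 => z i) (𝓝 0) (𝓝 0) := by
      have : ContinuousAt (fun z : Cn 2 => z i) 0 := by fun_prop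
      simpa [ContinuousAt] using this
    refine eventuallyEq_set.2 ?_
    filter_upwards [eventuallyEq_set.1 hBC, hi.eventually hB] with z h1 h2
    exact ⟨fun hz => graphMap_of_mem hij hz ▸ h2, fun hz => h1.2 (Or.inl hz)⟩
  refine ⟨hanalytic, ?_, fun B C hB hC hBC => ?_⟩
  · refine Eventually.frequently ?_ |>.filter_mono (pure_le_nhds (0 : Cn 2))
    exact show (0 : Cn 2) ∈ coordGraph i j h from by simp [coordGraph, h0]
  · rcases hB.eventually_mem_or_eventually_notMem hγ hγ0 with h1 | h1
    · exact Or.inl (key B C hBC h1)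
    rcases hC.eventually_mem_or_eventually_notMem hγ hγ0 with h2 | h2
    · exact Or.inr (key C B (by rwa [union_comm]) h2)
    exfalso
    have hBC' : ∀ᶠ t in 𝓝 0, graphMap i j h t ∈ B ∪ C := by
      have : Tendsto (graphMap i j h) (𝓝 0) (𝓝 0) := by
        simpa only [ContinuousAt, hγ0] using hγ.continuousAt
      filter_upwards [this.eventually (eventuallyEq_set.1 hBC)] with t ht
      exact ht.1 (graphMap_mem hij t)
    obtain ⟨t, h3, h4, h5⟩ :=
      (h1.and (h2.and (hBC'.filter_mono nhdsWithin_le_nhds))).exists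
    exact h5.elim h3 h4

theorem isSmoothGermAtWithTangent_coordGraph (hh : AnalyticAt ℂ h 0) (h0 : h 0 = 0)
    (h1 : HasDerivAt h 0 0) {T : Submodule ℂ (Cn 2)} (hT : ∀ v, v ∈ T ↔ v j = 0) :
    IsSmoothGermAtWithTangent (coordGraph i j h) 0 T := by
  set e : Cn 1 := EuclideanSpace.single 0 1 with he
  have he0 : e ≠ 0 := by simp [he]
  have hspan : ∀ y : Cn 1, y 0 • e = y := fun y => by
    ext k; rw [Subsingleton.elim k 0]; simp [he]
  have hd : HasFDerivAt (fun z : Cn 2 => (z j - h (z i)) • e)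
      ((EuclideanSpace.proj j : Cn 2 →L[ℂ] ℂ).smulRight e) 0 := by
    have hp : ∀ k : Fin 2, HasFDerivAt (fun z : Cn 2 => z k)
        (EuclideanSpace.proj k : Cn 2 →L[ℂ] ℂ) 0 := fun k =>
      (EuclideanSpace.proj k : Cn 2 →L[ℂ] ℂ).hasFDerivAt
    have h2 : HasFDerivAt (fun z : Cn 2 => h (z i)) (0 : Cn 2 →L[ℂ] ℂ) 0 := by
      have h3 : HasDerivAt h 0 ((0 : Cn 2) i) := by simpa using h1
      have h4 := h3.comp_hasFDerivAt (0 : Cn 2) (hp i)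
      exact h4.congr_fderiv (ContinuousLinearMap.ext fun v => zero_mul _)
    simpa using! ((hp j).sub h2).smul_const e
  refine ⟨1, fun z => (z j - h (z i)) • e, (analyticAt_graphEquation hh).smul analyticAt_const,
    by simp [h0], ?_, fun v => ?_, Eventually.of_forall fun z => ?_⟩
  · rw [hd.fderiv]
    exact fun y => ⟨EuclideanSpace.single j (y 0), by simp [hspan]⟩
  · rw [hd.fderiv, hT]
    simp [he0]
  · simp [he0, sub_eq_zero, coordGraph]

end Graph

/-! ### The local parameter on the branches -/

/-- The equation `x t = x³ + t³` of the nodal cubic is solved near the origin, with `x = s t`,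
by `s = t (1 + s³)`, that is `t = s / (1 + s³)`; `g` expresses `s` in terms of `t`. -/
theorem exists_branch_parameter : ∃ g : ℂ → ℂ, AnalyticAt ℂ g 0 ∧ g 0 = 0 ∧
    (∀ᶠ t in 𝓝 0, g t = t * (1 + g t ^ 3)) ∧
    ∀ᶠ s in 𝓝 0, ∀ t, s = t * (1 + s ^ 3) → g t = s := by
  set p : ℂ → ℂ := fun s => s / (1 + s ^ 3) with hp
  have hp0 : p 0 = 0 := by simp [hp]
  have hpa : AnalyticAt ℂ p 0 := by
    refine AnalyticAt.div (by fun_prop) (by fun_prop) (by simp)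
  have hne : ∀ᶠ s : ℂ in 𝓝 0, 1 + s ^ 3 ≠ 0 := by
    have : ContinuousAt (fun s : ℂ => 1 + s ^ 3) 0 := by fun_prop
    exact this.eventually_ne (by simp)
  have hpd : deriv p 0 ≠ 0 := by
    have h1 : HasDerivAt (fun s : ℂ => 1 + s ^ 3) 0 0 := by
      simpa using! (hasDerivAt_pow 3 (0 : ℂ)).const_add 1
    have h2 : HasDerivAt p 1 0 := by
      simpa using! (hasDerivAt_id (0 : ℂ)).div h1 (by simp)
    rw [h2.deriv]; exact one_ne_zero
  have hl := HasStrictDerivAt.eventually_left_inverse hpa.hasStrictDerivAt hpd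
  have hr := HasStrictDerivAt.eventually_right_inverse hpa.hasStrictDerivAt hpd
  have ha := hpa.analyticAt_localInverse hpd
  set g := hpa.hasStrictDerivAt.localInverse p _ 0 hpd with hg
  rw [hp0] at hr ha
  have hg0 : g 0 = 0 := by simpa [hp0] using hl.self_of_nhds
  have hgne : ∀ᶠ t in 𝓝 0, 1 + g t ^ 3 ≠ 0 := by
    have : Tendsto g (𝓝 0) (𝓝 0) := by simpa only [ContinuousAt, hg0] using ha.continuousAt
    exact this.eventually hne
  refine ⟨g, ha, hg0, ?_, ?_⟩
  · filter_upwards [hr, hgne] with t h1 h2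
    rw [hp, div_eq_iff h2] at h1
    exact h1
  · filter_upwards [hl, hne] with s h1 h2 t ht
    have : p s = t := (div_eq_iff h2).2 ht
    rw [← this]
    exact h1

/-! ### The chart at the point at infinity -/

theorem continuous_projectivization_mk' :
    Continuous (Projectivization.mk' ℂ : { v : Fin 3 → ℂ // v ≠ 0 } → P2) :=
  continuous_coinduced_rng

theorem chartAtA_eq_mk_iff (w : Cn 2) {v : Fin 3 → ℂ} (hv : v ≠ 0) :
    chartAtA w = Projectivization.mk ℂ v hv ↔ v 2 ≠ 0 ∧ w = !₂[v 0 / v 2, v 1 / v 2] := by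
  rw [chartAtA, Projectivization.mk_eq_mk_iff']
  constructor
  · rintro ⟨a, ha⟩
    have h0 : a * v 0 = w 0 := congrFun ha 0
    have h1 : a * v 1 = w 1 := congrFun ha 1
    have h2 : a * v 2 = 1 := congrFun ha 2
    have h3 : v 2 ≠ 0 := right_ne_zero_of_mul_eq_one h2
    refine ⟨h3, ?_⟩
    ext i
    fin_cases i
    · change w 0 = v 0 / v 2
      rw [← h0, eq_div_iff h3]; linear_combination v 0 * h2
    · change w 1 = v 1 / v 2
      rw [← h1, eq_div_iff h3]; linear_combination v 1 * h2
  · rintro ⟨h, rfl⟩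
    refine ⟨(v 2)⁻¹, ?_⟩
    ext i
    fin_cases i <;> simp [div_eq_inv_mul, h]

theorem affineEmb_eq_chartAtA_iff (z w : Cn 2) :
    affineEmb z = chartAtA w ↔ z 1 ≠ 0 ∧ w = !₂[1 / z 1, z 0 / z 1] := by
  rw [eq_comm, affineEmb, chartAtA_eq_mk_iff]
  simp

theorem pointA_eq_chartAtA : pointA = chartAtA 0 := by
  rw [eq_comm, pointA, chartAtA_eq_mk_iff]
  refine ⟨one_ne_zero, ?_⟩
  ext i
  fin_cases i <;> simp

theorem continuous_chartAtA : Continuous chartAtA := by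
  refine continuous_projectivization_mk'.comp (f := fun w : Cn 2 =>
    (⟨![w 0, w 1, 1], fun h => one_ne_zero (congrFun h 2)⟩ : { v : Fin 3 → ℂ // v ≠ 0 })) ?_
  refine Continuous.subtype_mk (continuous_pi fun i => ?_) _
  fin_cases i
  · exact (by fun_prop : Continuous fun w : Cn 2 => w 0)
  · exact (by fun_prop : Continuous fun w : Cn 2 => w 1)
  · exact (continuous_const : Continuous fun _ : Cn 2 => (1 : ℂ))

theorem isOpenEmbedding_chartAtA : IsOpenEmbedding chartAtA := by
  refine .of_continuous_injective_isOpenMap continuous_chartAtA (fun w w' h => ?_) fun V hV => ?_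
  · have h1 := ((chartAtA_eq_mk_iff w _).1 h).2
    have h2 := ((chartAtA_eq_mk_iff w' _).1 rfl).2
    exact h1.trans h2.symm
  · refine isOpen_coinduced.2 ?_
    set φ : { v : Fin 3 → ℂ // v ≠ 0 } → Cn 2 :=
      fun v => !₂[v.1 0 / v.1 2, v.1 1 / v.1 2] with hφ
    have heq : Projectivization.mk' ℂ ⁻¹' (chartAtA '' V) =
        {v : { v : Fin 3 → ℂ // v ≠ 0 } | v.1 2 ≠ 0} ∩ φ ⁻¹' V := by
      ext v
      constructor
      · rintro ⟨w, hw, h⟩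
        obtain ⟨h1, h2⟩ := (chartAtA_eq_mk_iff w v.2).1 h
        exact ⟨h1, show φ v ∈ V from (show w = φ v from h2) ▸ hw⟩
      · rintro ⟨h1, h2⟩
        exact ⟨φ v, h2, (chartAtA_eq_mk_iff (φ v) v.2).2 ⟨h1, rfl⟩⟩
    have hc : ∀ i : Fin 3, Continuous fun v : { v : Fin 3 → ℂ // v ≠ 0 } => v.1 i := fun i =>
      (continuous_apply i).comp continuous_subtype_val
    rw [heq]
    refine ContinuousOn.isOpen_inter_preimage (fun v hv => ?_)
      (isOpen_ne_fun (hc 2) continuous_const) hV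
    refine ContinuousAt.continuousWithinAt ?_
    refine (PiLp.continuous_toLp 2 _).continuousAt.comp (continuousAt_pi.2 fun i => ?_)
    fin_cases i
    · exact (hc 0).continuousAt.div (hc 2).continuousAt hv
    · exact (hc 1).continuousAt.div (hc 2).continuousAt hv

theorem nhdsWithin_image_chartAtA (Y : Set (Cn 2)) :
    𝓝[chartAtA '' Y] pointA = map chartAtA (𝓝[Y] 0) := by
  rw [isOpenEmbedding_chartAtA.isEmbedding.map_nhdsWithin_eq, pointA_eq_chartAtA]

/-! ### The projective cubic -/

theorem mk_mem_projCubic_iff {v : Fin 3 → ℂ} (hv : v ≠ 0) :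
    Projectivization.mk ℂ v hv ∈ projCubic ↔ v 1 * v 2 * v 0 = v 1 ^ 3 + v 0 ^ 3 := by
  obtain ⟨a, ha⟩ := Projectivization.exists_smul_eq_mk_rep ℂ v hv
  have h (i : Fin 3) : (Projectivization.mk ℂ v hv).rep i = a * v i := by rw [← ha]; rfl
  have ha0 : (a : ℂ) ^ 3 ≠ 0 := pow_ne_zero 3 a.ne_zero
  change (Projectivization.mk ℂ v hv).rep 1 * _ * _ = _ ↔ _
  rw [h, h, h]
  constructor
  · intro h1
    exact mul_left_cancel₀ ha0 (by linear_combination h1)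
  · intro h1
    linear_combination (a : ℂ) ^ 3 * h1

theorem isClosed_projCubic : IsClosed projCubic := by
  refine isClosed_coinduced.2 ?_
  have heq : Projectivization.mk' ℂ ⁻¹' projCubic =
      {v : { v : Fin 3 → ℂ // v ≠ 0 } | v.1 1 * v.1 2 * v.1 0 = v.1 1 ^ 3 + v.1 0 ^ 3} := by
    ext v
    exact mk_mem_projCubic_iff v.2
  rw [heq]
  have hc : ∀ i : Fin 3, Continuous fun v : { v : Fin 3 → ℂ // v ≠ 0 } => v.1 i := fun i =>
    (continuous_apply i).comp continuous_subtype_val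
  exact isClosed_eq (((hc 1).mul (hc 2)).mul (hc 0)) (((hc 1).pow 3).add ((hc 0).pow 3))

theorem affineEmb_mem_projCubic_iff (z : Cn 2) : affineEmb z ∈ projCubic ↔ z ∈ cubic := by
  rw [affineEmb, mk_mem_projCubic_iff]
  simp [cubic]

theorem chartAtA_mem_projCubic_iff (w : Cn 2) :
    chartAtA w ∈ projCubic ↔ w 1 * w 0 = w 1 ^ 3 + w 0 ^ 3 := by
  rw [chartAtA, mk_mem_projCubic_iff]
  simp

theorem projCubic_eq : projCubic = affineEmb '' cubic ∪ {pointA} := by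
  ext P
  constructor
  · induction P using Projectivization.ind with | h v hv => ?_
    intro h
    by_cases h0 : v 0 = 0
    · have h1 := (mk_mem_projCubic_iff hv).1 h
      have h1 : v 1 = 0 := by simpa [h0] using h1.symm
      have h2 : v 2 ≠ 0 := fun h2 => hv (by ext i; fin_cases i <;> assumption)
      right
      rw [mem_singleton_iff, pointA_eq_chartAtA, eq_comm, chartAtA_eq_mk_iff]
      refine ⟨h2, ?_⟩
      ext i
      fin_cases i <;> simp [h0, h1]
    · left
      have he : affineEmb !₂[v 1 / v 0, v 2 / v 0] = Projectivization.mk ℂ v hv := by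
        rw [affineEmb, Projectivization.mk_eq_mk_iff']
        refine ⟨(v 0)⁻¹, ?_⟩
        ext i
        fin_cases i <;> simp [div_eq_inv_mul, h0]
      rw [← he] at h ⊢
      exact ⟨_, (affineEmb_mem_projCubic_iff _).1 h, rfl⟩
  · rintro (⟨z, hz, rfl⟩ | rfl)
    · exact (affineEmb_mem_projCubic_iff z).2 hz
    · rw [pointA_eq_chartAtA, chartAtA_mem_projCubic_iff]
      simp

theorem pointA_notMem_range_affineEmb : pointA ∉ range affineEmb := by
  rintro ⟨z, hz⟩
  rw [pointA_eq_chartAtA, affineEmb_eq_chartAtA_iff] at hz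
  have : (0 : ℂ) = 1 / z 1 := congrArg (fun w : Cn 2 => w 0) hz.2
  exact one_div_ne_zero hz.1 this.symm

/-- The parametrization `x ↦ (x, x² + x⁻¹)` of the affine cubic by the punctured plane. -/
noncomputable def cubicParam (s : ℂ) : Cn 2 := !₂[s, s ^ 2 + s⁻¹]

theorem cubicParam_mem {s : ℂ} (hs : s ≠ 0) : cubicParam s ∈ cubic :=
  (mem_cubic_iff _).2 ⟨hs, rfl⟩

theorem cubicParam_of_mem {z : Cn 2} (hz : z ∈ cubic) : cubicParam (z 0) = z := by
  ext i
  fin_cases i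
  · rfl
  · exact ((mem_cubic_iff z).1 hz).2.symm

theorem affineEmb_cubicParam {s : ℂ} (hs : s ≠ 0) (h : 1 + s ^ 3 ≠ 0) :
    affineEmb (cubicParam s) = chartAtA !₂[s / (1 + s ^ 3), s ^ 2 / (1 + s ^ 3)] := by
  rw [affineEmb_eq_chartAtA_iff]
  have h1 : s ^ 2 + s⁻¹ = (1 + s ^ 3) / s := by field_simp; ring
  change s ^ 2 + s⁻¹ ≠ 0 ∧ _ = !₂[1 / (s ^ 2 + s⁻¹), s / (s ^ 2 + s⁻¹)]
  rw [h1]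
  refine ⟨div_ne_zero h hs, ?_⟩
  congr 1
  ext i
  fin_cases i
  · simp
  · simp; field_simp

theorem affineEmb_cubicParam_inv {s : ℂ} (hs : s ≠ 0) (h : 1 + s ^ 3 ≠ 0) :
    affineEmb (cubicParam s⁻¹) = chartAtA !₂[s ^ 2 / (1 + s ^ 3), s / (1 + s ^ 3)] := by
  rw [affineEmb_eq_chartAtA_iff]
  have h1 : s⁻¹ ^ 2 + s⁻¹⁻¹ = (1 + s ^ 3) / s ^ 2 := by field_simp
  change s⁻¹ ^ 2 + s⁻¹⁻¹ ≠ 0 ∧ _ = !₂[1 / (s⁻¹ ^ 2 + s⁻¹⁻¹), s⁻¹ / (s⁻¹ ^ 2 + s⁻¹⁻¹)]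
  rw [h1]
  refine ⟨div_ne_zero h (pow_ne_zero 2 hs), ?_⟩
  congr 1
  ext i
  fin_cases i
  · simp
  · simp; field_simp

theorem eventually_one_add_cube_ne_zero : ∀ᶠ s : ℂ in 𝓝 0, 1 + s ^ 3 ≠ 0 :=
  (by fun_prop : ContinuousAt (fun s : ℂ => 1 + s ^ 3) 0).eventually_ne (by simp)

theorem tendsto_pow_div_one_add_cube {k : ℕ} (hk : k ≠ 0) :
    Tendsto (fun s : ℂ => s ^ k / (1 + s ^ 3)) (𝓝 0) (𝓝 0) := by
  have : ContinuousAt (fun s : ℂ => s ^ k / (1 + s ^ 3)) 0 :=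
    ContinuousAt.div (by fun_prop) (by fun_prop) (by simp)
  simpa [ContinuousAt, hk] using this

theorem tendsto_toLp_pair {α : Type*} {l : Filter α} {a b : α → ℂ} (ha : Tendsto a l (𝓝 0))
    (hb : Tendsto b l (𝓝 0)) : Tendsto (fun s => (!₂[a s, b s] : Cn 2)) l (𝓝 0) := by
  have h : Tendsto (fun s => ![a s, b s]) l (𝓝 0) := tendsto_pi_nhds.2 fun i => by
    fin_cases i
    · simpa using! ha
    · simpa using! hb
  simpa using! ((PiLp.continuous_toLp 2 (fun _ : Fin 2 => ℂ)).tendsto 0).comp h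

theorem pointA_mem_closure : pointA ∈ closure (affineEmb '' cubic) := by
  have h : Tendsto (fun s : ℂ => affineEmb (cubicParam s)) (𝓝[≠] 0) (𝓝 pointA) := by
    have h1 : Tendsto (fun s : ℂ => (!₂[s ^ 1 / (1 + s ^ 3), s ^ 2 / (1 + s ^ 3)] : Cn 2))
        (𝓝[≠] 0) (𝓝 0) :=
      (tendsto_toLp_pair (tendsto_pow_div_one_add_cube one_ne_zero)
        (tendsto_pow_div_one_add_cube two_ne_zero)).mono_left nhdsWithin_le_nhds
    have h2 := (continuous_chartAtA.tendsto 0).comp h1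
    rw [← pointA_eq_chartAtA] at h2
    refine h2.congr' ?_
    filter_upwards [self_mem_nhdsWithin,
      eventually_one_add_cube_ne_zero.filter_mono nhdsWithin_le_nhds] with s h3 h4
    rw [affineEmb_cubicParam h3 h4, Function.comp_apply, pow_one]
  refine mem_closure_of_tendsto h ?_
  filter_upwards [self_mem_nhdsWithin] with s hs
  exact ⟨_, cubicParam_mem hs, rfl⟩

theorem closure_image_cubic : closure (affineEmb '' cubic) = projCubic := by
  refine Subset.antisymm (closure_minimal ?_ isClosed_projCubic) ?_
  · rw [projCubic_eq]; exact subset_union_left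
  · rw [projCubic_eq]
    exact union_subset subset_closure (singleton_subset_iff.2 pointA_mem_closure)

theorem mem_cubicClosureInChart_iff (w : Cn 2) :
    w ∈ cubicClosureInChart ↔ w 1 * w 0 = w 1 ^ 3 + w 0 ^ 3 := by
  rw [cubicClosureInChart, closure_image_cubic, mem_preimage, chartAtA_mem_projCubic_iff]

/-! ### The polynomial of the cubic -/

open MvPolynomial in
/-- The polynomial has degree one in `y`, with coefficients `x` and `-(x³ + 1)`, which
are coprime. -/
theorem irreducible_cubicPoly : Irreducible cubicPoly := by
  rw [cubicPoly, sub_eq_add_neg]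
  refine irreducible_mul_X_add _ _ 1 (X_ne_zero _) (by simp [vars_X]) ?_ ?_
  · rw [vars_neg]
    intro h
    rcases Finset.mem_union.1 (vars_add_subset _ _ h) with h | h
    · simpa [vars_X] using vars_pow _ _ h
    · simp at h
  · exact IsCoprime.isRelPrime ⟨-X 0 ^ 2, -1, by ring⟩

open MvPolynomial in
theorem totalDegree_cubicPoly : cubicPoly.totalDegree = 3 := by
  refine le_antisymm ?_ ?_
  · refine (totalDegree_sub _ _).trans (max_le ?_ ?_)
    · exact (totalDegree_mul _ _).trans (by simp)
    · exact (totalDegree_add _ _).trans (by simp [totalDegree_X_pow])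
  · have hc : coeff (Finsupp.single 0 3) cubicPoly = -1 := by
      have h1 : coeff (Finsupp.single (0 : Fin 2) 3) (X 0 * X 1 : MvPolynomial (Fin 2) ℂ) = 0 := by
        rw [coeff_mul_X', if_neg]
        simp
      have h2 : coeff (Finsupp.single (0 : Fin 2) 3) (1 : MvPolynomial (Fin 2) ℂ) = 0 := by
        rw [coeff_one, if_neg]
        intro h
        have := DFunLike.congr_fun h 0
        simp at this
      rw [cubicPoly, coeff_sub, coeff_add, h1, h2, coeff_X_pow]
      simp
    have := le_totalDegree (p := cubicPoly) (s := Finsupp.single 0 3) (by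
      rw [mem_support_iff, hc]; norm_num)
    simpa using this

theorem mem_cubic_iff_eval (z : Cn 2) :
    z ∈ cubic ↔ MvPolynomial.eval (fun i => z i) cubicPoly = 0 := by
  simp [cubic, cubicPoly, sub_eq_zero]

/-! ### The two branches at infinity -/

/-- Two graphs over different axes, both tangent to the axis over which they are taken, have
different germs. -/
theorem not_coordGraph_eventuallyLE {i j : Fin 2} (hij : i ≠ j) {h : ℂ → ℂ}
    (hh : AnalyticAt ℂ h 0) (h0 : h 0 = 0) (h1 : HasDerivAt h 0 0) :
    ¬ coordGraph i j h ≤ᶠ[𝓝 0] coordGraph j i h := by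
  intro hle
  have hle : ∀ᶠ z in 𝓝 0, z ∈ coordGraph i j h → z ∈ coordGraph j i h := hle
  have hγ : Tendsto (graphMap i j h) (𝓝 0) (𝓝 0) := by
    simpa only [ContinuousAt, graphMap_zero h0] using
      (analyticAt_graphMap (i := i) (j := j) hh).continuousAt
  have heq : (fun t => t) =ᶠ[𝓝 0] fun t => h (h t) := by
    filter_upwards [hγ.eventually hle] with t ht
    have := ht (graphMap_mem hij t)
    change graphMap i j h t i = h (graphMap i j h t j) at this
    rwa [graphMap_apply_left hij, graphMap_apply_right hij] at this
  have hd : HasDerivAt (fun t => h (h t)) (0 * 0) 0 :=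
    HasDerivAt.comp (h₂ := h) (0 : ℂ) (by rwa [h0]) h1
  have := (hd.congr_of_eventuallyEq heq).unique (hasDerivAt_id (0 : ℂ))
  norm_num at this

section Branch

variable {g : ℂ → ℂ}

theorem hasDerivAt_id_mul (hg : AnalyticAt ℂ g 0) (g0 : g 0 = 0) :
    HasDerivAt (fun t => t * g t) 0 0 := by
  refine ((hasDerivAt_id (0 : ℂ)).mul hg.differentiableAt.hasDerivAt).congr_deriv ?_
  simp [g0]

/-- In the sector `‖x‖ ≤ ‖t‖`, the nodal cubic `x t = x³ + t³` is the graph `x = t * g t`. -/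
theorem eventually_eq_of_norm_le
    (hg : ∀ᶠ s in 𝓝 0, ∀ t, s = t * (1 + s ^ 3) → g t = s) :
    ∀ᶠ t : ℂ in 𝓝 0, ∀ x, ‖x‖ ≤ ‖t‖ → x * t = x ^ 3 + t ^ 3 → x = t * g t := by
  obtain ⟨r, hr, hball⟩ := Metric.eventually_nhds_iff_ball.1 hg
  filter_upwards [Metric.ball_mem_nhds (0 : ℂ) (half_pos hr)] with t ht x hxt hx
  rw [mem_ball_zero_iff] at ht
  rcases eq_or_ne t 0 with rfl | ht0
  · simpa using hxt
  set s := x / t with hs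
  have hxs : x = s * t := (div_mul_cancel₀ x ht0).symm
  have hs1 : ‖s‖ ≤ 1 := by
    rw [hs, norm_div]; exact div_le_one_of_le₀ hxt (norm_nonneg t)
  have hst : s = t * (1 + s ^ 3) := by
    refine mul_right_cancel₀ (pow_ne_zero 2 ht0) ?_
    rw [hxs] at hx
    linear_combination hx
  have hsr : ‖s‖ < r := by
    have h1 : ‖1 + s ^ 3‖ ≤ 2 := by
      calc ‖1 + s ^ 3‖ ≤ ‖(1 : ℂ)‖ + ‖s ^ 3‖ := norm_add_le _ _
        _ = 1 + ‖s‖ ^ 3 := by rw [norm_one, norm_pow]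
        _ ≤ 1 + 1 := by gcongr; exact pow_le_one₀ (norm_nonneg s) hs1
        _ = 2 := by norm_num
    calc ‖s‖ = ‖t‖ * ‖1 + s ^ 3‖ := by conv_lhs => rw [hst, norm_mul]
      _ ≤ ‖t‖ * 2 := by gcongr
      _ < r := by linarith
  rw [hball s (mem_ball_zero_iff.2 hsr) t hst, mul_comm]
  exact hxs

theorem tendsto_coord (i : Fin 2) : Tendsto (fun z : Cn 2 => z i) (𝓝 0) (𝓝 0) := by
  have : ContinuousAt (fun z : Cn 2 => z i) 0 := by fun_prop
  simpa [ContinuousAt] using this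

theorem cubicClosureInChart_eventuallyEq
    (hg₁ : ∀ᶠ t in 𝓝 0, g t = t * (1 + g t ^ 3))
    (hg₂ : ∀ᶠ s in 𝓝 0, ∀ t, s = t * (1 + s ^ 3) → g t = s) :
    cubicClosureInChart =ᶠ[𝓝 0]
      (coordGraph 0 1 (fun t => t * g t) ∪ coordGraph 1 0 (fun t => t * g t) : Set (Cn 2)) := by
  have hg₃ := eventually_eq_of_norm_le hg₂
  refine eventuallyEq_set.2 ?_
  filter_upwards [(tendsto_coord 0).eventually hg₁, (tendsto_coord 1).eventually hg₁,
    (tendsto_coord 0).eventually hg₃, (tendsto_coord 1).eventually hg₃] with z h0 h1 h2 h3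
  rw [mem_cubicClosureInChart_iff]
  constructor
  · intro hz
    rcases le_total ‖z 1‖ ‖z 0‖ with hle | hle
    · exact Or.inl (h2 _ hle hz)
    · exact Or.inr (h3 _ hle (by linear_combination hz))
  · rintro (hz | hz)
    · have hz : z 1 = z 0 * g (z 0) := hz
      rw [hz]
      linear_combination z 0 ^ 2 * h0
    · have hz : z 0 = z 1 * g (z 1) := hz
      rw [hz]
      linear_combination z 1 ^ 2 * h1

/-- The filter `alongBranch Y` is computed by a parametrization `c` of the branch by a punctured
disc: `q` is the same parametrization in the chart at infinity, and `σ` inverts it. -/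
theorem alongBranch_eq_map {Y : Set (Cn 2)} {c q : ℂ → Cn 2} {σ : Cn 2 → ℂ}
    (hq : Tendsto q (𝓝[≠] 0) (𝓝[Y] 0))
    (hc : ∀ᶠ s in 𝓝[≠] 0, affineEmb (c s) = chartAtA (q s))
    (hσ : Tendsto σ (𝓝[Y] 0) (𝓝 0))
    (hinv : ∀ᶠ w in 𝓝[Y] 0, ∀ ζ, affineEmb ζ = chartAtA w → σ w ≠ 0 ∧ ζ = c (σ w)) :
    alongBranch Y = map c (𝓝[≠] 0) := by
  rw [alongBranch, nhdsWithin_image_chartAtA]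
  refine le_antisymm (fun S hS => ?_) ?_
  · have hS : ∀ᶠ s in 𝓝[≠] (0 : ℂ), c s ∈ S := hS
    have hS' : ∀ᶠ s in 𝓝 (0 : ℂ), s ≠ 0 → c s ∈ S := eventually_nhdsWithin_iff.1 hS
    refine mem_comap.2 ⟨_, image_mem_map (hinv.and (hσ.eventually hS')), ?_⟩
    rintro ζ ⟨w, ⟨h1, h2⟩, h3⟩
    obtain ⟨h4, h5⟩ := h1 ζ h3.symm
    rw [h5]
    exact h2 h4
  · have h : Tendsto (fun s => affineEmb (c s)) (𝓝[≠] 0) (map chartAtA (𝓝[Y] 0)) :=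
      (tendsto_map.comp hq).congr' (hc.mono fun s hs => hs.symm)
    exact (tendsto_comap_iff.2 h)

theorem eventually_nhdsNE_ne_zero_and : ∀ᶠ s : ℂ in 𝓝[≠] 0, s ≠ 0 ∧ 1 + s ^ 3 ≠ 0 :=
  (eventually_mem_nhdsWithin.mono fun _ h => h).and
    (eventually_one_add_cube_ne_zero.filter_mono nhdsWithin_le_nhds)

theorem eventually_parameter_eq
    (hg₂ : ∀ᶠ s in 𝓝 0, ∀ t, s = t * (1 + s ^ 3) → g t = s) :
    ∀ᶠ s : ℂ in 𝓝[≠] 0,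
      s ^ 2 / (1 + s ^ 3) = s ^ 1 / (1 + s ^ 3) * g (s ^ 1 / (1 + s ^ 3)) := by
  filter_upwards [hg₂.filter_mono nhdsWithin_le_nhds, eventually_nhdsNE_ne_zero_and] with s h1 h2
  rw [h1 _ (by rw [pow_one, div_mul_cancel₀ _ h2.2])]
  ring

theorem tendsto_comp_coord (hg : AnalyticAt ℂ g 0) (g0 : g 0 = 0) (i : Fin 2) (Y : Set (Cn 2)) :
    Tendsto (fun w : Cn 2 => g (w i)) (𝓝[Y] 0) (𝓝 0) := by
  have h : Tendsto g (𝓝 0) (𝓝 0) := by simpa only [ContinuousAt, g0] using hg.continuousAt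
  exact h.comp ((tendsto_coord i).mono_left nhdsWithin_le_nhds)

theorem alongBranch_coordGraph_zero_one (hg : AnalyticAt ℂ g 0) (g0 : g 0 = 0)
    (hg₁ : ∀ᶠ t in 𝓝 0, g t = t * (1 + g t ^ 3))
    (hg₂ : ∀ᶠ s in 𝓝 0, ∀ t, s = t * (1 + s ^ 3) → g t = s) :
    alongBranch (coordGraph 0 1 fun t => t * g t) = map cubicParam (𝓝[≠] 0) := by
  refine alongBranch_eq_map
    (q := fun s => !₂[s ^ 1 / (1 + s ^ 3), s ^ 2 / (1 + s ^ 3)]) (σ := fun w => g (w 0))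
    (tendsto_nhdsWithin_iff.2 ⟨?_, eventually_parameter_eq hg₂⟩) ?_
    (tendsto_comp_coord hg g0 0 _) ?_
  · exact (tendsto_toLp_pair (tendsto_pow_div_one_add_cube one_ne_zero)
      (tendsto_pow_div_one_add_cube two_ne_zero)).mono_left nhdsWithin_le_nhds
  · filter_upwards [eventually_nhdsNE_ne_zero_and] with s hs
    rw [affineEmb_cubicParam hs.1 hs.2, pow_one]
  · filter_upwards [self_mem_nhdsWithin,
      ((tendsto_coord 0).mono_left nhdsWithin_le_nhds).eventually hg₁] with w hw h1 ζ hζ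
    have hw : w 1 = w 0 * g (w 0) := hw
    obtain ⟨h2, h3⟩ := (affineEmb_eq_chartAtA_iff ζ w).1 hζ
    have e0 : w 0 = 1 / ζ 1 := by rw [h3]; rfl
    have e1 : w 1 = ζ 0 / ζ 1 := by rw [h3]; rfl
    have h0 : w 0 ≠ 0 := by rw [e0]; exact one_div_ne_zero h2
    have hg0 : g (w 0) = ζ 0 := by
      refine mul_left_cancel₀ h0 ?_
      rw [← hw, e1, e0]; ring
    have hgne : g (w 0) ≠ 0 := fun h => by
      rw [h] at h1
      norm_num at h1
      exact h0 h1.symm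
    refine ⟨hgne, ?_⟩
    rw [hg0] at h1 hgne ⊢
    refine (cubicParam_of_mem ?_).symm
    change ζ 0 * ζ 1 = ζ 0 ^ 3 + 1
    rw [e0] at h1
    have h4 : ζ 1 * ζ 0 = 1 + ζ 0 ^ 3 := by
      conv_lhs => rw [h1]
      field_simp
    linear_combination h4

theorem alongBranch_coordGraph_one_zero (hg : AnalyticAt ℂ g 0) (g0 : g 0 = 0)
    (hg₁ : ∀ᶠ t in 𝓝 0, g t = t * (1 + g t ^ 3))
    (hg₂ : ∀ᶠ s in 𝓝 0, ∀ t, s = t * (1 + s ^ 3) → g t = s) :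
    alongBranch (coordGraph 1 0 fun t => t * g t) = map (fun s => cubicParam s⁻¹) (𝓝[≠] 0) := by
  refine alongBranch_eq_map
    (q := fun s => !₂[s ^ 2 / (1 + s ^ 3), s ^ 1 / (1 + s ^ 3)]) (σ := fun w => g (w 1))
    (tendsto_nhdsWithin_iff.2 ⟨?_, eventually_parameter_eq hg₂⟩) ?_
    (tendsto_comp_coord hg g0 1 _) ?_
  · exact (tendsto_toLp_pair (tendsto_pow_div_one_add_cube two_ne_zero)
      (tendsto_pow_div_one_add_cube one_ne_zero)).mono_left nhdsWithin_le_nhds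
  · filter_upwards [eventually_nhdsNE_ne_zero_and] with s hs
    rw [affineEmb_cubicParam_inv hs.1 hs.2, pow_one]
  · filter_upwards [self_mem_nhdsWithin,
      ((tendsto_coord 1).mono_left nhdsWithin_le_nhds).eventually hg₁] with w hw h1 ζ hζ
    have hw : w 0 = w 1 * g (w 1) := hw
    obtain ⟨h2, h3⟩ := (affineEmb_eq_chartAtA_iff ζ w).1 hζ
    have e0 : w 0 = 1 / ζ 1 := by rw [h3]; rfl
    have e1 : w 1 = ζ 0 / ζ 1 := by rw [h3]; rfl
    have h0 : w 1 * g (w 1) ≠ 0 := by rw [← hw, e0]; exact one_div_ne_zero h2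
    have hw1 := left_ne_zero_of_mul h0
    have hgne := right_ne_zero_of_mul h0
    have hζ0 : ζ 0 ≠ 0 := fun h => hw1 (by rw [e1, h, zero_div])
    have hg0 : g (w 1) = (ζ 0)⁻¹ := by
      refine mul_left_cancel₀ hw1 ?_
      rw [← hw, e1, e0]; field_simp
    refine ⟨hgne, ?_⟩
    rw [hg0, inv_inv]
    refine (cubicParam_of_mem ?_).symm
    change ζ 0 * ζ 1 = ζ 0 ^ 3 + 1
    rw [hg0, e1] at h1
    field_simp at h1
    linear_combination h1

end Branch

theorem tendsto_affineEmb_of_parameter {Y : Set (Cn 2)} {c : ℂ → Cn 2}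
    (hY : alongBranch Y = map c (𝓝[≠] 0)) {F : Filter (Cn 2)} {σ : Cn 2 → ℂ}
    (hσ : Tendsto σ F (𝓝 0)) (hF : ∀ᶠ z in F, σ z ≠ 0 ∧ c (σ z) = z) :
    Tendsto affineEmb F (𝓝[chartAtA '' Y] pointA) := by
  have hσ' : Tendsto σ F (𝓝[≠] 0) := tendsto_nhdsWithin_iff.2 ⟨hσ, hF.mono fun z hz => hz.1⟩
  have hle : F ≤ alongBranch Y := by
    rw [hY]
    exact (tendsto_id'.1 ((tendsto_map.comp hσ').congr' (hF.mono fun z hz => hz.2)))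
  exact (tendsto_comap (f := affineEmb)).mono_left hle

/-! ### Asymptotics on the two ends of the cubic -/

/-- The quantity `‖s‖² (1 + ‖cubicParam s‖²) = ‖s‖⁴ (1 + ‖cubicParam s⁻¹‖²)`. -/
noncomputable def cubicWeight (s : ℂ) : ℝ := ‖s‖ ^ 2 + ‖s‖ ^ 4 + ‖1 + s ^ 3‖ ^ 2

theorem tendsto_log_cubicWeight :
    Tendsto (fun s => Real.log (cubicWeight s)) (𝓝[≠] 0) (𝓝 0) := by
  have h1 : ContinuousAt cubicWeight 0 := by unfold cubicWeight; fun_prop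
  have h2 : cubicWeight 0 = 1 := by simp [cubicWeight]
  have h3 := h1.log (by rw [h2]; exact one_ne_zero)
  have h4 : Tendsto (fun s => Real.log (cubicWeight s)) (𝓝 0) (𝓝 0) := by
    simpa [ContinuousAt, h2] using h3
  exact h4.mono_left nhdsWithin_le_nhds

theorem rhoOne_eq (z : Cn 2) : rhoOne z = Real.log (1 + ‖z 0‖ ^ 2 + ‖z 1‖ ^ 2) / 2 := by
  rw [rhoOne, Real.log_sqrt (by positivity), EuclideanSpace.norm_sq_eq, Fin.sum_univ_two, add_assoc]

theorem rhoOne_cubicParam {s : ℂ} (hs : s ≠ 0) :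
    rhoOne (cubicParam s) = Real.log (cubicWeight s) / 2 - Real.log ‖s‖ := by
  have hsp : 0 < ‖s‖ := norm_pos_iff.2 hs
  have h1 : s ^ 2 + s⁻¹ = (1 + s ^ 3) / s := by field_simp; ring
  have h2 : cubicWeight s = ‖s‖ ^ 2 * (1 + ‖s‖ ^ 2 + ‖s ^ 2 + s⁻¹‖ ^ 2) := by
    rw [h1, norm_div, cubicWeight]; field_simp
  rw [rhoOne_eq, h2, Real.log_mul (by positivity) (by positivity), Real.log_pow]
  change Real.log (1 + ‖s‖ ^ 2 + ‖s ^ 2 + s⁻¹‖ ^ 2) / 2 = _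
  push_cast
  ring

theorem rhoOne_cubicParam_inv {s : ℂ} (hs : s ≠ 0) :
    rhoOne (cubicParam s⁻¹) = Real.log (cubicWeight s) / 2 - 2 * Real.log ‖s‖ := by
  have hsp : 0 < ‖s‖ := norm_pos_iff.2 hs
  have h1 : s⁻¹ ^ 2 + s⁻¹⁻¹ = (1 + s ^ 3) / s ^ 2 := by field_simp
  have h2 : cubicWeight s = ‖s‖ ^ 4 * (1 + ‖s⁻¹‖ ^ 2 + ‖s⁻¹ ^ 2 + s⁻¹⁻¹‖ ^ 2) := by
    rw [h1, norm_div, norm_inv, norm_pow, cubicWeight]; field_simp; ring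
  rw [rhoOne_eq, h2, Real.log_mul (by positivity) (by positivity), Real.log_pow]
  change Real.log (1 + ‖s⁻¹‖ ^ 2 + ‖s⁻¹ ^ 2 + s⁻¹⁻¹‖ ^ 2) / 2 = _
  push_cast
  ring

theorem eventually_log_norm_le (a : ℝ) : ∀ᶠ s : ℂ in 𝓝[≠] 0, Real.log ‖s‖ ≤ a := by
  have h : Tendsto (fun s : ℂ => Real.log ‖s‖) (𝓝[≠] 0) atBot :=
    Real.tendsto_log_nhdsGT_zero.comp tendsto_norm_nhdsNE_zero
  exact h.eventually_le_atBot a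

theorem eventually_uFun_cubicParam :
    ∀ᶠ s : ℂ in 𝓝[≠] 0, uFun (cubicParam s) = -Real.log ‖s‖ := by
  filter_upwards [eventually_log_norm_le (-1)] with s hs
  change max (-Real.log ‖s‖) (2 * Real.log ‖s‖ + 1) = _
  exact max_eq_left (by linarith)

theorem eventually_uFun_cubicParam_inv :
    ∀ᶠ s : ℂ in 𝓝[≠] 0, uFun (cubicParam s⁻¹) = 1 - 2 * Real.log ‖s‖ := by
  filter_upwards [eventually_log_norm_le 0] with s hs
  change max (-Real.log ‖s⁻¹‖) (2 * Real.log ‖s⁻¹‖ + 1) = _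
  rw [norm_inv, Real.log_inv, max_eq_right (by linarith)]
  ring

theorem limsup_eta_sub_rhoOne {Y : Set (Cn 2)} {c : ℂ → Cn 2} {b : ℝ}
    (hY : alongBranch Y = map c (𝓝[≠] 0))
    (hb : Tendsto (fun s => uFun (c s) - rhoOne (c s)) (𝓝[≠] 0) (𝓝 b)) :
    limsup (fun ζ : Cn 2 => eta ζ - (rhoOne ζ : EReal)) (alongBranch Y) = b := by
  have h : Tendsto (fun ζ : Cn 2 => eta ζ - (rhoOne ζ : EReal)) (map c (𝓝[≠] 0))
      (𝓝 (b : EReal)) := by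
    rw [tendsto_map'_iff]
    exact (continuous_coe_real_ereal.tendsto b).comp hb
  rw [hY]
  exact h.limsup_eq

theorem tendsto_uFun_sub_rhoOne :
    Tendsto (fun s => uFun (cubicParam s) - rhoOne (cubicParam s)) (𝓝[≠] 0) (𝓝 0) := by
  have h := tendsto_log_cubicWeight.div_const 2 |>.neg
  rw [zero_div, neg_zero] at h
  refine h.congr' ?_
  filter_upwards [eventually_uFun_cubicParam, eventually_nhdsNE_ne_zero_and] with s h1 h2
  rw [h1, rhoOne_cubicParam h2.1]
  ring

theorem tendsto_uFun_sub_rhoOne_inv :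
    Tendsto (fun s => uFun (cubicParam s⁻¹) - rhoOne (cubicParam s⁻¹)) (𝓝[≠] 0) (𝓝 1) := by
  have h := (tendsto_log_cubicWeight.div_const 2).const_sub 1
  rw [zero_div, sub_zero] at h
  refine h.congr' ?_
  filter_upwards [eventually_uFun_cubicParam_inv, eventually_nhdsNE_ne_zero_and] with s h1 h2
  rw [h1, rhoOne_cubicParam_inv h2.1]
  ring

/-! ### Nonextendability -/

/-- Along the branch `x' = h t`, with `h t = t * g t`, the function `ψ + log ‖t‖` tends to `0`,
hence by `exists_le_of_le_on_branch` its upper limit at the point at infinity is less than `1`; but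
along the other branch it tends to `1`. -/
theorem not_exists_lelongClass_extension :
    ¬ ∃ ψ : Cn 2 → EReal, ψ ∈ LelongClass 1 (univ : Set (Cn 2)) ∧ EqOn ψ eta cubic := by
  rintro ⟨ψ, hψ, heq⟩
  obtain ⟨g, hg, g0, hg₁, -⟩ := exists_branch_parameter
  have hgt : Tendsto g (𝓝 0) (𝓝 0) := by simpa only [ContinuousAt, g0] using hg.continuousAt
  set h : ℂ → ℂ := fun t => t * g t with hh
  have hhan : AnalyticAt ℂ h 0 := analyticAt_id.mul hg
  have hht : Tendsto h (𝓝 0) (𝓝 0) := by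
    simpa only [ContinuousAt, hh, g0, mul_zero] using hhan.continuousAt
  have hlog : Tendsto (fun s : ℂ => Real.log ‖1 + s ^ 3‖) (𝓝 0) (𝓝 0) := by
    have : ContinuousAt (fun s : ℂ => Real.log ‖1 + s ^ 3‖) 0 :=
      ContinuousAt.log (by fun_prop) (by simp)
    simpa [ContinuousAt] using this
  -- on the first branch `ψ + log ‖t‖ = -log ‖1 + g t ^ 3‖`
  have hsmall : ∀ᶠ t in 𝓝 0, t ≠ 0 →
      ψ (branchCoord h (t, 0)) ≤ ((1 / 4 - Real.log ‖t‖ : ℝ) : EReal) := by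
    have hu : ∀ᶠ s : ℂ in 𝓝 0, s ≠ 0 → uFun (cubicParam s) = -Real.log ‖s‖ :=
      eventually_nhdsWithin_iff.1 eventually_uFun_cubicParam
    have hl : ∀ᶠ s : ℂ in 𝓝 0, -(1 / 4) < Real.log ‖1 + s ^ 3‖ :=
      hlog.eventually (lt_mem_nhds (by norm_num))
    filter_upwards [hg₁, hgt.eventually hu, hgt.eventually hl,
      hgt.eventually eventually_one_add_cube_ne_zero] with t h1 h2 h3 h4 ht
    have hgne : g t ≠ 0 := fun h5 => by
      rw [h5] at h1
      norm_num at h1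
      exact ht h1.symm
    have hpt : branchCoord h (t, 0) = cubicParam (g t) := by
      have e1 : (0 + h t) / t = g t := by simp only [hh]; field_simp; ring
      have e2 : t⁻¹ = g t ^ 2 + (g t)⁻¹ := by
        have e3 : t⁻¹ = (1 + g t ^ 3) / g t := by
          rw [eq_div_iff hgne]
          conv_lhs => rw [h1]
          field_simp
        rw [e3]; field_simp; ring
      simp only [branchCoord, cubicParam, e1, e2]
    rw [hpt, heq (cubicParam_mem hgne), eta, h2 hgne, EReal.coe_le_coe_iff]
    have e4 : Real.log ‖g t‖ = Real.log ‖t‖ + Real.log ‖1 + g t ^ 3‖ := by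
      conv_lhs => rw [h1, norm_mul]
      exact Real.log_mul (norm_ne_zero_iff.2 ht) (norm_ne_zero_iff.2 h4)
    linarith
  obtain ⟨R, hR, hball⟩ :=
    Metric.eventually_nhds_iff_ball.1 (hsmall.and hhan.eventually_analyticAt)
  obtain ⟨N, r, r', hr, hr', hle⟩ := exists_le_of_le_on_branch hψ hR
    (fun t ht => (hball t (mem_ball_zero_iff.2 ht)).2) (show (1 / 4 : ℝ) < 1 / 2 by norm_num)
    (fun t ht0 ht => (hball t (mem_ball_zero_iff.2 ht)).1 ht0)
  -- the second branch in the coordinates `(t, w)` adapted to the first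
  set t : ℂ → ℂ := fun s => s ^ 2 / (1 + s ^ 3) with ht
  set w : ℂ → ℂ := fun s => s ^ 1 / (1 + s ^ 3) - h (t s) with hw
  have htt : Tendsto t (𝓝[≠] 0) (𝓝 0) :=
    (tendsto_pow_div_one_add_cube two_ne_zero).mono_left nhdsWithin_le_nhds
  have hwt : Tendsto w (𝓝[≠] 0) (𝓝 0) := by
    have h1 := ((tendsto_pow_div_one_add_cube one_ne_zero).mono_left nhdsWithin_le_nhds).sub
      (hht.comp htt)
    rw [sub_zero] at h1
    exact h1
  -- on the second branch `ψ + log ‖t‖ = 1 - log ‖1 + s ^ 3‖`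
  have hineq : ∀ᶠ s in 𝓝[≠] (0 : ℂ), 1 / 2 ≤ N * ‖w s‖ ^ 2 + Real.log ‖1 + s ^ 3‖ := by
    filter_upwards [eventually_nhdsNE_ne_zero_and, eventually_uFun_cubicParam_inv,
      htt.eventually (Metric.ball_mem_nhds 0 hr), hwt.eventually (Metric.ball_mem_nhds 0 hr')]
      with s ⟨h1, h2⟩ h3 h4 h5
    rw [dist_zero_right] at h4 h5
    have ht0 : t s ≠ 0 := div_ne_zero (pow_ne_zero 2 h1) h2
    have hpt : branchCoord h (t s, w s) = cubicParam s⁻¹ := by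
      have e1 : (w s + h (t s)) / t s = s⁻¹ := by
        simp only [hw, sub_add_cancel, ht]; field_simp
      have e2 : (t s)⁻¹ = s⁻¹ ^ 2 + s⁻¹⁻¹ := by
        simp only [ht]; field_simp
      simp only [branchCoord, cubicParam, e1, e2]
    have h6 := hle (t s) (w s) ht0 h4 h5.le
    rw [hpt, heq (cubicParam_mem (inv_ne_zero h1)), eta, h3, EReal.coe_le_coe_iff] at h6
    have e3 : Real.log ‖t s‖ = 2 * Real.log ‖s‖ - Real.log ‖1 + s ^ 3‖ := by
      simp only [ht, norm_div, norm_pow]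
      rw [Real.log_div (pow_ne_zero 2 (norm_ne_zero_iff.2 h1)) (norm_ne_zero_iff.2 h2),
        Real.log_pow]
      push_cast; ring
    linarith
  have hlim : Tendsto (fun s => N * ‖w s‖ ^ 2 + Real.log ‖1 + s ^ 3‖) (𝓝[≠] 0) (𝓝 0) := by
    simpa using ((hwt.norm.pow 2).const_mul N).add (hlog.mono_left nhdsWithin_le_nhds)
  have := ge_of_tendsto hlim hineq
  norm_num at this

/-! ### The cubic and its branches: conclusion -/

theorem mainTheorem11 :
    -- `X` is the irreducible cubic with equation `xy = x³ + 1`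
    (Irreducible cubicPoly ∧ cubicPoly.totalDegree = 3 ∧
      ∀ z : Cn 2, z ∈ cubic ↔ MvPolynomial.eval (fun i => z i) cubicPoly = 0) ∧
    -- its closure in the projective plane, which has one point at infinity
    closure (affineEmb '' cubic) = projCubic ∧
    closure (affineEmb '' cubic) = affineEmb '' cubic ∪ {pointA} ∧
    pointA ∉ Set.range affineEmb ∧
    -- `X` is the graph of `y = x² + x⁻¹` over the punctured plane
    (∀ z : Cn 2, z ∈ cubic ↔ z 0 ≠ 0 ∧ z 1 = z 0 ^ 2 + (z 0)⁻¹) ∧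
    -- `u` is psh where `x ≠ 0`, and its restriction to `X` is in the Lelong class of `X`
    IsPsh {z : Cn 2 | z 0 ≠ 0} eta ∧
    eta ∈ LelongClass 1 cubic ∧
    -- the two branches at the point at infinity, and the upper limits along them
    (∃ X₁ X₂ : Set (Cn 2),
      IsIrreducibleComponentAt X₁ cubicClosureInChart 0 ∧
      IsIrreducibleComponentAt X₂ cubicClosureInChart 0 ∧
      ¬ (X₁ =ᶠ[𝓝 0] X₂) ∧
      (∀ Y : Set (Cn 2), IsIrreducibleComponentAt Y cubicClosureInChart 0 →
        Y =ᶠ[𝓝 0] X₁ ∨ Y =ᶠ[𝓝 0] X₂) ∧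
      cubicClosureInChart =ᶠ[𝓝 0] (X₁ ∪ X₂ : Set (Cn 2)) ∧
      -- `X₁` is tangent to the line `{x = 0}`, `X₂` to the line `{t = 0}`
      (∃ T₁ : Submodule ℂ (Cn 2), (∀ v : Cn 2, v ∈ T₁ ↔ v 1 = 0) ∧
        IsSmoothGermAtWithTangent X₁ 0 T₁) ∧
      (∃ T₂ : Submodule ℂ (Cn 2), (∀ v : Cn 2, v ∈ T₂ ↔ v 0 = 0) ∧
        IsSmoothGermAtWithTangent X₂ 0 T₂) ∧
      -- on `X`: if `x → 0` the point tends to `a` along `X₁`, if `x → ∞` along `X₂`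
      Tendsto affineEmb (comap (fun z : Cn 2 => z 0) (𝓝 0) ⊓ 𝓟 cubic)
        (𝓝[chartAtA '' X₁] pointA) ∧
      Tendsto affineEmb (comap (fun z : Cn 2 => ‖z 0‖) atTop ⊓ 𝓟 cubic)
        (𝓝[chartAtA '' X₂] pointA) ∧
      limsup (fun ζ : Cn 2 => eta ζ - (rhoOne ζ : EReal)) (alongBranch X₁) = 0 ∧
      limsup (fun ζ : Cn 2 => eta ζ - (rhoOne ζ : EReal)) (alongBranch X₂) = 1) ∧
    -- `η` has no extension in the Lelong class of the plane
    ¬ ∃ ψ : Cn 2 → EReal, ψ ∈ LelongClass 1 (Set.univ : Set (Cn 2)) ∧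
        Set.EqOn ψ eta cubic := by
  obtain ⟨g, hg, g0, hg₁, hg₂⟩ := exists_branch_parameter
  have hh : AnalyticAt ℂ (fun t => t * g t) 0 := analyticAt_id.mul hg
  have h0 : (fun t => t * g t) 0 = 0 := by simp
  have h1 := hasDerivAt_id_mul hg g0
  have hX₁ : IsIrreducibleGermAt (coordGraph 0 1 fun t => t * g t) 0 :=
    isIrreducibleGermAt_coordGraph (by decide) hh h0
  have hX₂ : IsIrreducibleGermAt (coordGraph 1 0 fun t => t * g t) 0 :=
    isIrreducibleGermAt_coordGraph (by decide) hh h0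
  have hunion := cubicClosureInChart_eventuallyEq hg₁ hg₂
  have h₁₂ := not_coordGraph_eventuallyLE (i := 0) (j := 1) (by decide) hh h0 h1
  have h₂₁ := not_coordGraph_eventuallyLE (i := 1) (j := 0) (by decide) hh h0 h1
  have hb₁ := alongBranch_coordGraph_zero_one hg g0 hg₁ hg₂
  have hb₂ := alongBranch_coordGraph_one_zero hg g0 hg₁ hg₂
  have htangent : ∀ i : Fin 2, ∃ T : Submodule ℂ (Cn 2), ∀ v : Cn 2, v ∈ T ↔ v i = 0 := fun i =>
    ⟨LinearMap.ker (EuclideanSpace.proj i : Cn 2 →L[ℂ] ℂ).toLinearMap, fun v => Iff.rfl⟩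
  obtain ⟨T₁, hT₁⟩ := htangent 1
  obtain ⟨T₂, hT₂⟩ := htangent 0
  refine ⟨⟨irreducible_cubicPoly, totalDegree_cubicPoly, mem_cubic_iff_eval⟩,
    closure_image_cubic, by rw [closure_image_cubic, projCubic_eq],
    pointA_notMem_range_affineEmb, mem_cubic_iff, isPsh_eta, eta_mem_lelongClass,
    ⟨coordGraph 0 1 fun t => t * g t, coordGraph 1 0 fun t => t * g t,
      isIrreducibleComponentAt_of_eq_union hX₁ hX₂ hunion h₁₂,
      isIrreducibleComponentAt_of_eq_union hX₂ hX₁ (by rwa [union_comm]) h₂₁,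
      fun h => h₁₂ h.le, fun Y hY => hY.eq_or_eq_of_eq_union hX₁ hX₂ hunion, hunion,
      ⟨T₁, hT₁, isSmoothGermAtWithTangent_coordGraph hh h0 h1 hT₁⟩,
      ⟨T₂, hT₂, isSmoothGermAtWithTangent_coordGraph hh h0 h1 hT₂⟩,
      tendsto_affineEmb_of_parameter hb₁ (σ := fun z => z 0) ?_ ?_,
      tendsto_affineEmb_of_parameter hb₂ (σ := fun z => (z 0)⁻¹) ?_ ?_,
      limsup_eta_sub_rhoOne hb₁ tendsto_uFun_sub_rhoOne,
      limsup_eta_sub_rhoOne hb₂ tendsto_uFun_sub_rhoOne_inv⟩,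
    not_exists_lelongClass_extension⟩
  · exact tendsto_comap.mono_left inf_le_left
  · filter_upwards [mem_inf_of_right (mem_principal_self cubic)] with z hz
    exact ⟨((mem_cubic_iff z).1 hz).1, cubicParam_of_mem hz⟩
  · refine Tendsto.mono_left ?_ inf_le_left
    rw [tendsto_zero_iff_norm_tendsto_zero]
    simp only [norm_inv]
    exact tendsto_inv_atTop_zero.comp tendsto_comap
  · filter_upwards [mem_inf_of_right (mem_principal_self cubic)] with z hz
    exact ⟨inv_ne_zero ((mem_cubic_iff z).1 hz).1, by rw [inv_inv]; exact cubicParam_of_mem hz⟩
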